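/- **Setting.** For every value $\lambda\in\mathbb N$ of the security parameter let $\mathcal R:\{0,1\}^\lambda\to\{0,1\}$ be a uniformly random function (the secret random oracle). A zero-bit binary code in the secret random oracle model consists of randomized algorithms with oracle access to $\mathcal R$: $\mathsf{KeyGen}^{\mathcal R}$ outputs a key $\mathsf{sk}\in\{0,1\}^{\ell(\lambda)}$, where $\ell$ is bounded by a polynomial; $\mathsf{Enc}^{\mathcal R}(\mathsf{sk})$ outputs a codeword in $\{0,1\}^{n(\lambda)}$; and $\mathsf{Dec}^{\mathcal R}(\mathsf{sk},x)$ outputs $1$ or $\bot$ for $x\in\{0,1\}^{n(\lambda)}$. No bound on the running time of these algorithms is assumed. Let $\rho=\rho(\lambda)\in[0,1]$. The $\rho$-noise channel $\mathcal N_\rho$ maps $x$ to $x\oplus e$, where the bits of $e$ are independent and equal to $1$ with probability $(1-\rho)/2$. For real-valued functions $\delta,\varepsilon,\mu$ of $\lambda$, the code is a *$(\delta,\varepsilon,\mu)$ pseudorandom code robust to $\mathcal N_\rho$* if the following hold, with probabilities taken over $\mathcal R$ and all internal coins. * *Completeness.* For every $\lambda$, $\Pr[\mathsf{Dec}^{\mathcal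 R}(\mathsf{sk},\tilde c)=1]\ge 1-\delta$, where $\mathsf{sk}\leftarrow\mathsf{KeyGen}^{\mathcal R}$, $c\leftarrow\mathsf{Enc}^{\mathcal R}(\mathsf{sk})$ and $\tilde c\leftarrow\mathcal N_\rho(c)$. * *Soundness.* For every $\lambda$ and every fixed $x\in\{0,1\}^{n}$, $\Pr[\mathsf{Dec}^{\mathcal R}(\mathsf{sk},x)=\bot]\ge 1-\mu$, where $\mathsf{sk}\leftarrow\mathsf{KeyGen}^{\mathcal R}$. * *Statistical pseudorandomness.* For every polynomially bounded $m=m(\lambda)$ and every computationally unbounded adversary $\mathcal A$ without access to $\mathcal R$, for all sufficiently large $\lambda$, $$\bigl|\Pr[\mathcal A(c_1,\dots,c_m)=1]-\Pr[\mathcal A(u_1,\dots,u_m)=1]\bigr|\le\varepsilon(\lambda),$$ where $c_1,\dots,c_m$ are fresh outputs of $\mathsf{Enc}^{\mathcal R}(\mathsf{sk})$ for one $\mathcal R$ and one $\mathsf{sk}\leftarrow\mathsf{KeyGen}^{\mathcal R}$, and $u_1,\dots,u_m$ are independent and uniform on $\{0,1\}^n$. **Theorem.** There is an absolute constant $C>0$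 such that the following holds for every zero-bit $(\delta,\varepsilon,\mu)$ pseudorandom code in the secret random oracle model that is robust to the $\rho$-noise channel and in which one execution of each of $\mathsf{KeyGen}^{\mathcal R}$, $\mathsf{Enc}^{\mathcal R}$, $\mathsf{Dec}^{\mathcal R}$ makes at most $Q=Q(\lambda)\ge 1$ queries to $\mathcal R$. 1. There is a function $\eta:\mathbb N\to[0,\infty)$ with $\eta=\omega(1-\rho)$ as $\lambda\to\infty$ (that is, $1-\rho=o(\eta)$) such that for every $\lambda$ $$\delta+\mu\;\ge\;1-Q^2\cdot\lambda^{-\eta}-C\,Q^2\sqrt{\varepsilon n}.$$ That is, $\delta+\mu\ge 1-Q^2\lambda^{-\omega(1-\rho)}-O(Q^2\sqrt{\varepsilon n})$. (Here $0^0=1$, and $\sqrt{t}$ is read as $0$ for $t<0$.) 2. Consequently, if in addition $n$ and $Q$ are polynomially bounded, $\varepsilon$ is negligible, and the noise rate is at least constant (there is $r<1$ with $\rho(\lambda)\le r$ for all large $\lambda$), then there is no non-trivial completeness–soundness gap: $\delta+\mu\ge 1-\nu$ for every $\lambda$, for some negligible function $\nu$. -/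

import Mathlib

open Filter Asymptotics

noncomputable section

/-- Bit strings of length `n`. -/
abbrev BitString (n : ℕ) : Type := Fin n → Bool

/-- The set of all functions `R : {0,1}^κ → {0,1}`, from which the random oracle is drawn
uniformly. -/
abbrev Oracle (κ : ℕ) : Type := BitString κ → Bool

/-- A deterministic adaptive query algorithm with outputs in `α` and queries in `{0,1}^κ`: it either
stops with an output, or asks one query and continues depending on the answer bit. -/
inductive QueryAlg (κ : ℕ) (α : Type) : Type
  | ret (a : α) : QueryAlg κ α
  | ask (q : BitString κ) (next : Bool → QueryAlg κ α) : QueryAlg κ α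

namespace QueryAlg

/-- The output of the algorithm when its queries are answered by `R`. -/
def run {κ : ℕ} {α : Type} (R : Oracle κ) : QueryAlg κ α → α
  | ret a => a
  | ask q next => run R (next (R q))

/-- The number of queries in the execution in which the queries are answered by `R`
(repeated queries are counted each time). -/
def numQueries {κ : ℕ} {α : Type} (R : Oracle κ) : QueryAlg κ α → ℕ
  | ret _ => 0
  | ask q next => numQueries R (next (R q)) + 1

end QueryAlg

/-- A randomized query algorithm: the internal coins, tossed independently of the oracle, determine
a deterministic query algorithm. There is no bound on the running time. -/
abbrev RandAlg (κ : ℕ) (α : Type) : Type := PMF (QueryAlg κ α)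

namespace RandAlg

/-- The distribution, over the internal coins, of the output on the fixed oracle `R`. -/
def run {κ : ℕ} {α : Type} (A : RandAlg κ α) (R : Oracle κ) : PMF α :=
  PMF.map (QueryAlg.run R) A

/-- Every execution, for all coins and all oracles, makes at most `q` queries. -/
def QueriesAtMost {κ : ℕ} {α : Type} (A : RandAlg κ α) (q : ℕ) : Prop :=
  ∀ t ∈ A.support, ∀ R : Oracle κ, t.numQueries R ≤ q

end RandAlg

/-- The distribution of `m` independent samples of `p`. -/
def iidSamples {α : Type} [Fintype α] (p : PMF α) (m : ℕ) : PMF (Fin m → α) :=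
  PMF.ofFintype (fun x => ∏ i, p (x i)) (by
    classical
    have h := Finset.prod_univ_sum (fun _ : Fin m => (Finset.univ : Finset α))
      (fun _ a => p a)
    rw [Fintype.piFinset_univ] at h
    rw [← h]
    have h1 : ∑ a, p a = 1 := by rw [← tsum_fintype (L := .unconditional _)]; exact p.tsum_coe
    simp [h1])

/-- The probability `(1 - ρ) / 2` with which the `ρ`-noise channel flips a bit. -/
def flipProb (ρ : unitInterval) : NNReal := Real.toNNReal ((1 - (ρ : ℝ)) / 2)

theorem flipProb_le_one (ρ : unitInterval) : flipProb ρ ≤ 1 := by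
  have := ρ.2.1
  unfold flipProb
  rw [Real.toNNReal_le_one]
  linarith

/-- The error on one bit: `true` with probability `(1 - ρ) / 2`, and `false` otherwise. -/
def bitError (ρ : unitInterval) : PMF Bool :=
  PMF.ofFintype (fun b => if b then (flipProb ρ : ENNReal) else 1 - (flipProb ρ : ENNReal)) (by
    have h : (flipProb ρ : ENNReal) ≤ 1 := by exact_mod_cast flipProb_le_one ρ
    simp [add_tsub_cancel_of_le h])

/-- The `ρ`-noise channel (binary symmetric channel): `x` is mapped to `x ⊕ e`, where the bits of `e`
are independent and equal to `1` with probability `(1 - ρ) / 2`. -/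
def noise (ρ : unitInterval) {n : ℕ} (x : BitString n) : PMF (BitString n) :=
  PMF.map (fun e : BitString n => fun i => xor (x i) (e i))
    (iidSamples (bitError ρ) n)

/-- `f` is bounded by a polynomial. -/
def PolyBounded (f : ℕ → ℕ) : Prop :=
  ∃ p : Polynomial ℕ, ∀ κ, f κ ≤ p.eval κ

/-- `f` decays faster than every inverse polynomial. -/
def Negligible (f : ℕ → ℝ) : Prop :=
  SuperpolynomialDecay atTop (fun κ : ℕ => (κ : ℝ)) f

/-- The algorithms of a zero-bit code over the binary alphabet, for every value `κ` of the security
parameter. All of them have access to the same oracle `{0,1}^κ → {0,1}`. The decoder outputs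
`true` for the message `1` and `false` for `⊥`. -/
structure ZeroBitCode where
  keyLen : ℕ → ℕ
  blockLen : ℕ → ℕ
  keyGen : ∀ κ, RandAlg κ (BitString (keyLen κ))
  enc : ∀ κ, BitString (keyLen κ) → RandAlg κ (BitString (blockLen κ))
  dec : ∀ κ, BitString (keyLen κ) → BitString (blockLen κ) → RandAlg κ Bool

namespace ZeroBitCode

/-- The joint distribution of the random oracle and a secret key generated with it. -/
def setup (P : ZeroBitCode) (κ : ℕ) : PMF (Oracle κ × BitString (P.keyLen κ)) :=
  (PMF.uniformOfFintype (Oracle κ)).bind fun R =>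
    PMF.map (fun sk => (R, sk)) ((P.keyGen κ).run R)

/-- The output of the decoder on a codeword sent through the `ρ`-noise channel. -/
def completenessExp (P : ZeroBitCode) (κ : ℕ) (ρ : unitInterval) : PMF Bool :=
  (P.setup κ).bind fun s =>
    ((P.enc κ s.2).run s.1).bind fun c =>
      (noise ρ c).bind fun c' => (P.dec κ s.2 c').run s.1

/-- The output of the decoder on a fixed string. -/
def soundnessExp (P : ZeroBitCode) (κ : ℕ) (x : BitString (P.blockLen κ)) : PMF Bool :=
  (P.setup κ).bind fun s => (P.dec κ s.2 x).run s.1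

/-- The output of an adversary that receives `m` fresh encodings under one key and one oracle. The
adversary has no access to the oracle. -/
def realExp (P : ZeroBitCode) (κ m : ℕ)
    (A : (Fin m → BitString (P.blockLen κ)) → PMF Bool) : PMF Bool :=
  (P.setup κ).bind fun s => (iidSamples ((P.enc κ s.2).run s.1) m).bind A

/-- The output of an adversary that receives `m` independent uniformly random strings. -/
def idealExp (P : ZeroBitCode) (κ m : ℕ)
    (A : (Fin m → BitString (P.blockLen κ)) → PMF Bool) : PMF Bool :=
  (iidSamples (PMF.uniformOfFintype (BitString (P.blockLen κ))) m).bind A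

/-- `δ`-completeness, or robustness to the `ρ`-noise channel. -/
def IsComplete (P : ZeroBitCode) (ρ : ℕ → unitInterval) (δ : ℕ → ℝ) : Prop :=
  ∀ κ, 1 - δ κ ≤ (P.completenessExp κ (ρ κ) true).toReal

/-- `μ`-soundness. -/
def IsSound (P : ZeroBitCode) (μ : ℕ → ℝ) : Prop :=
  ∀ κ, ∀ x : BitString (P.blockLen κ), 1 - μ κ ≤ (P.soundnessExp κ x false).toReal

/-- Statistical `ε`-pseudorandomness: every computationally unbounded adversary that sees
polynomially many samples has advantage at most `ε` for all sufficiently large values of the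
security parameter (how large may depend on the adversary). -/
def IsPseudorandom (P : ZeroBitCode) (ε : ℕ → ℝ) : Prop :=
  ∀ m : ℕ → ℕ, PolyBounded m →
    ∀ A : ∀ κ, (Fin (m κ) → BitString (P.blockLen κ)) → PMF Bool,
      ∀ᶠ κ in atTop,
        |(P.realExp κ (m κ) (A κ) true).toReal - (P.idealExp κ (m κ) (A κ) true).toReal| ≤ ε κ

/-- A zero-bit `(δ, ε, μ)` pseudorandom code, robust to the `ρ`-noise channel, in the secret random
oracle model, with keys of polynomial length. -/
structure IsPRC (P : ZeroBitCode) (ρ : ℕ → unitInterval) (δ ε μ : ℕ → ℝ) : Prop where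
  polyKey : PolyBounded P.keyLen
  complete : P.IsComplete ρ δ
  pseudorandom : P.IsPseudorandom ε
  sound : P.IsSound μ

/-- One execution of each of the three algorithms makes at most `Q` oracle queries. -/
def QueriesAtMost (P : ZeroBitCode) (Q : ℕ → ℕ) : Prop :=
  ∀ κ, (P.keyGen κ).QueriesAtMost (Q κ) ∧
    ∀ sk : BitString (P.keyLen κ), (P.enc κ sk).QueriesAtMost (Q κ) ∧
      ∀ x : BitString (P.blockLen κ), (P.dec κ sk x).QueriesAtMost (Q κ)

end ZeroBitCode

end

/-! Encoder and decoder share only the key and the oracle. The plan is to move everything useful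
that they share into a short string `z = (sk, K)`, where `K` is a partial oracle, and to show two
things: given `z`, one codeword is nearly uniform, and given `z`, encoder and decoder behave as if
their remaining oracles were independent. A noisy codeword then looks to the decoder like an
independent uniform string, which soundness forbids it to accept often.

Choice of `K`. Start from the trace of the key generation, given which the oracle is uniform among
its extensions. Then reveal at most `D` further answers, each time to the unanswered query that the
encoder asks with the largest probability. The expected number of distinct unanswered encoder
queries is at most `Q` and drops in expectation by that largest probability, so at some stage the
average heaviest query has probability at most `Q / D` (`exists_light_extension`).

Near-uniformity given `z`. There are at most `2^ℓ * 2^(κ(Q+D)) * e^2` values of `z`. An unbounded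
adversary with polynomially many samples maximises over all `z` the empirical bias of the event that
best separates the codeword law given `z` from uniform. A union bound keeps this maximum below `2s`
on uniform samples, while on real samples its mean is at least the average distance `T` from uniform
(`exists_statistic`). Hence `T ≤ 2ε + 2s`.

Independence given `z`. Common and independent oracles differ only if encoder and decoder ask a
common query outside `K` (`commonAccept_le_add`). Up to the distance from uniform, the codeword and
its noisy version are `ρ`-correlated uniform strings, so two-function hypercontractivity bounds the
probability that both ask `q` by `(α_q β_q)^(1/(1+ρ))`, with `α_q`, `β_q` the two query
probabilities. The exponent exceeds `1/2` by at least `(1-ρ)/4`; lightness of the remaining queries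
turns this surplus into a factor `(Q/D)^((1-ρ)/4)`, and the rest sums to at most `Q`
(`collisionProb_le`).

Altogether `1 - δ - μ ≤ 2T + Q (Q/D)^((1-ρ)/4)`. Taking `D` to be larger and larger powers of `κ`
gives each exponent `k(1-ρ)` for all large `κ`, and a diagonal choice of `k` gives the exponent
`ω(1-ρ)`. The one delicate range is `Q = 1` with `κ^(-k(1-ρ))` close to `1`, where the cruder bound
`commonAccept_le_mul` takes over. -/

noncomputable section

/-! ### Partial oracles and product measures -/

/-- A partial assignment of answer bits to the queries in `X`. -/
abbrev PartialOracle (X : Type) : Type := X → Option Bool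

/-- The law of one answer bit given partial information on it. -/
def bitProb : Option Bool → Bool → ℝ
  | none, _ => 1 / 2
  | some b, b' => if b = b' then 1 else 0

/-- The indicator of the consistency of an answer bit with partial information on it. -/
def bitMatch : Option Bool → Bool → ℝ
  | none, _ => 1
  | some b, b' => if b = b' then 1 else 0

theorem bitProb_nonneg (o : Option Bool) (b : Bool) : 0 ≤ bitProb o b := by
  cases o <;> simp only [bitProb] <;> (try split_ifs) <;> norm_num

theorem bitMatch_nonneg (o : Option Bool) (b : Bool) : 0 ≤ bitMatch o b := by
  cases o <;> simp only [bitMatch] <;> (try split_ifs) <;> norm_num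

theorem sum_bitProb (o : Option Bool) : ∑ b, bitProb o b = 1 := by
  rcases o with _ | (_ | _) <;> simp [bitProb]

section PartialOracle

set_option linter.unusedSectionVars false

variable {X : Type} [Fintype X] [DecidableEq X]

theorem sum_prod_eq_prod_sum {β : Type} [Fintype β] (f : X → β → ℝ) :
    ∑ R : X → β, ∏ q, f q (R q) = ∏ q, ∑ b, f q b := by
  rw [Finset.prod_univ_sum, Fintype.piFinset_univ]

/-- The law of a uniformly random oracle conditioned on extending `K`. -/
def oracleProb (K : PartialOracle X) (R : X → Bool) : ℝ := ∏ q, bitProb (K q) (R q)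

/-- The indicator of the event that `R` extends `S`. -/
def oracleMatch (S : PartialOracle X) (R : X → Bool) : ℝ := ∏ q, bitMatch (S q) (R q)

/-- The probability that a random oracle extending `K` extends `S`. -/
def matchProb (K S : PartialOracle X) : ℝ := ∑ R, oracleProb K R * oracleMatch S R

/-- The probability that a random oracle extending `K` extends both `S` and `T`. -/
def jointMatchProb (K S T : PartialOracle X) : ℝ :=
  ∑ R, oracleProb K R * (oracleMatch S R * oracleMatch T R)

/-- The number of queries answered by a partial oracle. -/
def PartialOracle.size (S : PartialOracle X) : ℕ := (Finset.univ.filter fun q => S q ≠ none).card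

/-- `S` and `T` answer a common query that `K` does not answer. -/
def Collide (K S T : PartialOracle X) : Prop := ∃ q, K q = none ∧ S q ≠ none ∧ T q ≠ none

theorem oracleProb_nonneg (K : PartialOracle X) (R : X → Bool) : 0 ≤ oracleProb K R :=
  Finset.prod_nonneg fun _ _ => bitProb_nonneg _ _

theorem oracleMatch_nonneg (S : PartialOracle X) (R : X → Bool) : 0 ≤ oracleMatch S R :=
  Finset.prod_nonneg fun _ _ => bitMatch_nonneg _ _

theorem matchProb_nonneg (K S : PartialOracle X) : 0 ≤ matchProb K S :=
  Finset.sum_nonneg fun _ _ => mul_nonneg (oracleProb_nonneg _ _) (oracleMatch_nonneg _ _)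

theorem jointMatchProb_nonneg (K S T : PartialOracle X) : 0 ≤ jointMatchProb K S T :=
  Finset.sum_nonneg fun _ _ => mul_nonneg (oracleProb_nonneg _ _)
    (mul_nonneg (oracleMatch_nonneg _ _) (oracleMatch_nonneg _ _))

theorem sum_oracleProb (K : PartialOracle X) : ∑ R, oracleProb K R = 1 := by
  unfold oracleProb
  rw [sum_prod_eq_prod_sum fun q b => bitProb (K q) b]
  exact Finset.prod_eq_one fun q _ => sum_bitProb (K q)

theorem matchProb_eq_prod (K S : PartialOracle X) :
    matchProb K S = ∏ q, ∑ b, bitProb (K q) b * bitMatch (S q) b := by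
  rw [← sum_prod_eq_prod_sum fun q b => bitProb (K q) b * bitMatch (S q) b]
  simp only [matchProb, oracleProb, oracleMatch, Finset.prod_mul_distrib]

theorem jointMatchProb_eq_prod (K S T : PartialOracle X) :
    jointMatchProb K S T =
      ∏ q, ∑ b, bitProb (K q) b * (bitMatch (S q) b * bitMatch (T q) b) := by
  rw [← sum_prod_eq_prod_sum fun q b => bitProb (K q) b * (bitMatch (S q) b * bitMatch (T q) b)]
  simp only [jointMatchProb, oracleProb, oracleMatch, Finset.prod_mul_distrib]

/-- The answers of a random extension of `K` are independent across queries, and a query that is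
answered by `K` is deterministic. Thus only a common query outside `K` can correlate the two events.
-/
theorem jointMatchProb_of_not_collide {K S T : PartialOracle X} (h : ¬ Collide K S T) :
    jointMatchProb K S T = matchProb K S * matchProb K T := by
  rw [jointMatchProb_eq_prod, matchProb_eq_prod, matchProb_eq_prod, ← Finset.prod_mul_distrib]
  refine Finset.prod_congr rfl fun q _ => ?_
  simp only [Collide, not_exists] at h
  have hq := h q
  revert hq
  generalize K q = k
  generalize S q = s
  generalize T q = t
  rcases k with _ | (_ | _) <;> rcases s with _ | (_ | _) <;> rcases t with _ | (_ | _) <;>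
    simp [bitProb, bitMatch]

/-- At a common query outside `K` the joint probability is at most `1/2` against a product of `1/4`;
each query of `S` therefore costs at most a factor `2`. This is useful only for very small `Q`. -/
theorem jointMatchProb_le (K S T : PartialOracle X) :
    jointMatchProb K S T ≤ 2 ^ S.size * (matchProb K S * matchProb K T) := by
  have h2 : (2 : ℝ) ^ S.size = ∏ q, if S q ≠ none then 2 else 1 := by
    rw [PartialOracle.size, Finset.prod_ite]
    simp
  rw [jointMatchProb_eq_prod, matchProb_eq_prod, matchProb_eq_prod, ← Finset.prod_mul_distrib, h2,
    ← Finset.prod_mul_distrib]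
  refine Finset.prod_le_prod (fun q _ => Finset.sum_nonneg fun b _ =>
    mul_nonneg (bitProb_nonneg _ _) (mul_nonneg (bitMatch_nonneg _ _) (bitMatch_nonneg _ _)))
    fun q _ => ?_
  generalize K q = k
  generalize S q = s
  generalize T q = t
  rcases k with _ | (_ | _) <;> rcases s with _ | (_ | _) <;> rcases t with _ | (_ | _) <;>
    simp [bitProb, bitMatch] <;> norm_num

theorem oracleProb_eq_update (K : PartialOracle X) {q : X} (hq : K q = none) (R : X → Bool) :
    oracleProb K R = ∑ b, 1 / 2 * oracleProb (Function.update K q (some b)) R := by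
  have h : ∀ b, oracleProb (Function.update K q (some b)) R =
      bitProb (some b) (R q) * ∏ x ∈ Finset.univ.erase q, bitProb (K x) (R x) := by
    intro b
    rw [oracleProb, ← Finset.mul_prod_erase _ _ (Finset.mem_univ q)]
    congr 1
    · simp
    · refine Finset.prod_congr rfl fun x hx => ?_
      rw [Function.update_of_ne (Finset.ne_of_mem_erase hx)]
  simp only [h]
  rw [oracleProb, ← Finset.mul_prod_erase _ _ (Finset.mem_univ q), hq]
  cases R q <;> simp [bitProb]

theorem matchProb_eq_update (K S : PartialOracle X) {q : X} (hq : K q = none) :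
    matchProb K S = ∑ b, 1 / 2 * matchProb (Function.update K q (some b)) S := by
  simp only [matchProb, oracleProb_eq_update K hq, Finset.sum_mul, Finset.mul_sum]
  rw [Finset.sum_comm]
  simp only [mul_assoc]

theorem oracleMatch_eq_ite (S : PartialOracle X) (R : X → Bool) [Decidable (∀ q b, S q = some b → R q = b)] :
    oracleMatch S R = if ∀ q b, S q = some b → R q = b then 1 else 0 := by
  split_ifs with h
  · refine Finset.prod_eq_one fun q _ => ?_
    have := h q
    revert this
    rcases S q with _ | b <;> simp [bitMatch, eq_comm]
  · push Not at h
    obtain ⟨q, b, h1, h2⟩ := h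
    refine Finset.prod_eq_zero (Finset.mem_univ q) ?_
    simp [bitMatch, h1, h2.symm]

theorem oracleProb_mul_pow_size (S : PartialOracle X) (R : X → Bool) :
    (1 / 2) ^ Fintype.card X * oracleMatch S R = (1 / 2) ^ S.size * oracleProb S R := by
  have h2 : (1 / 2 : ℝ) ^ S.size = ∏ q, if S q ≠ none then 1 / 2 else 1 := by
    rw [PartialOracle.size, Finset.prod_ite]
    simp
  have h3 : (1 / 2 : ℝ) ^ Fintype.card X = ∏ _q : X, 1 / 2 := by simp
  rw [h2, h3, oracleMatch, oracleProb, ← Finset.prod_mul_distrib, ← Finset.prod_mul_distrib]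
  refine Finset.prod_congr rfl fun q _ => ?_
  rcases S q with _ | b <;> simp [bitProb, bitMatch]

theorem PartialOracle.size_update_le (K : PartialOracle X) (q : X) (b : Bool) :
    PartialOracle.size (Function.update K q (some b)) ≤ K.size + 1 := by
  unfold PartialOracle.size
  refine (Finset.card_le_card (t := insert q (Finset.univ.filter fun x => K x ≠ none)) ?_).trans
    (Finset.card_insert_le _ _)
  intro x hx
  by_cases h : x = q
  · simp [h]
  · simpa [h, Function.update_of_ne h] using hx

/-- There are few partial oracles that answer few queries. -/
theorem card_size_le [Nonempty X] (D : ℕ) :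
    ((Finset.univ.filter fun S : PartialOracle X => S.size ≤ D).card : ℝ) ≤
      (Fintype.card X : ℝ) ^ D * Real.exp 2 := by
  set N : ℝ := (Fintype.card X : ℝ) with hN
  have hN1 : 1 ≤ N := by rw [hN]; exact_mod_cast Fintype.card_pos
  have hN0 : 0 < N := by linarith
  -- With weight `N⁻¹ ^ size` the sum over all partial oracles factorises over queries, each
  -- contributing `1 + 2 / N` for no answer or one of two answers. The partial oracles to be counted
  -- have weight at least `N⁻¹ ^ D`.
  have hpow : ∀ S : PartialOracle X, (∏ q, if S q ≠ none then N⁻¹ else 1) = N⁻¹ ^ S.size := by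
    intro S
    rw [PartialOracle.size, Finset.prod_ite]
    simp
  have h1 : ∑ S : PartialOracle X, N⁻¹ ^ S.size = (1 + 2 * N⁻¹) ^ Fintype.card X := by
    simp only [← hpow]
    rw [sum_prod_eq_prod_sum fun _ (o : Option Bool) => if o ≠ none then N⁻¹ else 1]
    simp [Fintype.sum_option]
  have h2 : (1 + 2 * N⁻¹) ^ Fintype.card X ≤ Real.exp 2 := by
    calc (1 + 2 * N⁻¹) ^ Fintype.card X ≤ Real.exp (2 * N⁻¹) ^ Fintype.card X := by
          gcongr
          linarith [Real.add_one_le_exp (2 * N⁻¹)]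
      _ = Real.exp 2 := by
          rw [← Real.exp_nat_mul, ← hN]
          congr 1
          field_simp
  have h3 : ((Finset.univ.filter fun S : PartialOracle X => S.size ≤ D).card : ℝ) * N⁻¹ ^ D ≤
      ∑ S : PartialOracle X, N⁻¹ ^ S.size := by
    rw [← nsmul_eq_mul]
    refine (Finset.card_nsmul_le_sum _ (fun S : PartialOracle X => N⁻¹ ^ S.size) _ ?_).trans
      (Finset.sum_le_sum_of_subset_of_nonneg (Finset.filter_subset _ _) fun _ _ _ => by positivity)
    intro S hS
    exact pow_le_pow_of_le_one (by positivity) (inv_le_one_of_one_le₀ hN1)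
      (Finset.mem_filter.1 hS).2
  rw [h1] at h3
  have h4 := h3.trans h2
  rw [inv_pow, ← div_eq_mul_inv, div_le_iff₀ (by positivity)] at h4
  linarith

end PartialOracle

/-! ### Leaves of query algorithms -/

namespace QueryAlg

variable {κ : ℕ} {α : Type}

/-- The queries and answers in the execution in which the queries are answered by `R`. -/
def trace (R : Oracle κ) : QueryAlg κ α → PartialOracle (BitString κ)
  | ret _ => fun _ => none
  | ask q next => Function.update (trace R (next (R q))) q (some (R q))

theorem eq_of_trace_eq_some (R : Oracle κ) (t : QueryAlg κ α) (q : BitString κ) (b : Bool)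
    (h : t.trace R q = some b) : R q = b := by
  induction t with
  | ret a => simp [trace] at h
  | ask p next ih =>
    by_cases hp : q = p
    · subst hp
      simpa [trace] using h
    · rw [trace, Function.update_of_ne hp] at h
      exact ih _ h

theorem run_and_trace_congr (R R' : Oracle κ) (t : QueryAlg κ α)
    (h : ∀ q b, t.trace R q = some b → R' q = b) :
    t.run R' = t.run R ∧ t.trace R' = t.trace R := by
  induction t with
  | ret a => simp [trace, run]
  | ask p next ih =>
    have hp : R' p = R p := h p _ (by simp [trace])
    have := ih (R p) fun q b hq => by
      by_cases hqp : q = p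
      · subst hqp
        rw [hp, eq_of_trace_eq_some R _ _ _ hq]
      · exact h q b (by rw [trace, Function.update_of_ne hqp, hq])
    simp only [run, trace, hp]
    exact ⟨this.1, by rw [this.2]⟩

theorem size_trace_le (R : Oracle κ) (t : QueryAlg κ α) :
    (t.trace R).size ≤ t.numQueries R := by
  induction t with
  | ret a => simp [trace, PartialOracle.size]
  | ask p next ih =>
    exact (PartialOracle.size_update_le _ _ _).trans (Nat.succ_le_succ (ih _))

/-- Some execution outputs `a` and has the trace `S`. -/
def IsLeaf (t : QueryAlg κ α) (a : α) (S : PartialOracle (BitString κ)) : Prop :=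
  ∃ R, t.run R = a ∧ t.trace R = S

/-- This separates coins from oracle: being a leaf does not involve `R`, and a leaf is reached
exactly when `R` extends its trace. It is what allows output probabilities to be linear in
`oracleMatch`. -/
theorem isLeaf_and_extends_iff (R : Oracle κ) (t : QueryAlg κ α) (a : α)
    (S : PartialOracle (BitString κ)) :
    (t.IsLeaf a S ∧ ∀ q b, S q = some b → R q = b) ↔ t.run R = a ∧ t.trace R = S := by
  constructor
  · rintro ⟨⟨R', rfl, rfl⟩, h⟩
    exact run_and_trace_congr R' R t h
  · rintro ⟨rfl, rfl⟩
    exact ⟨⟨R, rfl, rfl⟩, eq_of_trace_eq_some R t⟩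

end QueryAlg

/-- The weights of the pairs of an output and a trace of a randomized query algorithm. Such a pair
occurs in the execution with the oracle `R` with probability `W a S` if `R` extends `S`, and with
probability `0` otherwise. -/
structure IsLeafWeight {X α : Type} [Fintype X] [DecidableEq X] [Fintype α]
    (W : α → PartialOracle X → ℝ) (Q : ℕ) : Prop where
  nonneg : ∀ a S, 0 ≤ W a S
  sum_eq_one : ∀ R : X → Bool, ∑ a, ∑ S, W a S * oracleMatch S R = 1
  size_le : ∀ a S, W a S ≠ 0 → S.size ≤ Q

open Classical in
/-- The probability, over the coins of `A`, that `A` has a leaf with output `a` and trace `S`. -/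
def leafWeight {κ : ℕ} {α : Type} (A : RandAlg κ α) (a : α) (S : PartialOracle (BitString κ)) : ℝ :=
  (∑' t : QueryAlg κ α, if t.IsLeaf a S then A t else 0).toReal

theorem PMF.tsum_ite_ne_top {β : Type} (p : PMF β) (P : β → Prop) [DecidablePred P] :
    ∑' t, (if P t then p t else 0) ≠ ⊤ := by
  refine ne_top_of_le_ne_top p.tsum_coe_ne_top (ENNReal.tsum_le_tsum fun t => ?_)
  split_ifs <;> simp

theorem toReal_run_eq_sum {κ : ℕ} {α : Type} (A : RandAlg κ α) (R : Oracle κ) (a : α) :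
    (A.run R a).toReal = ∑ S, leafWeight A a S * oracleMatch S R := by
  classical
  have h : A.run R a = ∑ S : PartialOracle (BitString κ),
      (∑' t : QueryAlg κ α, if t.IsLeaf a S then A t else 0) *
        (if ∀ q b, S q = some b → R q = b then 1 else 0) := by
    rw [RandAlg.run, PMF.map_apply]
    simp only [← ENNReal.tsum_mul_right]
    rw [← tsum_fintype (L := .unconditional _), ENNReal.tsum_comm]
    refine tsum_congr fun t => ?_
    rw [tsum_fintype]
    have h1 : ∀ S : PartialOracle (BitString κ), (if t.IsLeaf a S then A t else 0) *
        (if ∀ q b, S q = some b → R q = b then 1 else 0) =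
        if t.trace R = S then (if a = t.run R then A t else 0) else 0 := by
      intro S
      have := QueryAlg.isLeaf_and_extends_iff R t a S
      rw [mul_ite, mul_one, mul_zero, ← ite_and, ← ite_and]
      refine if_congr ?_ rfl rfl
      rw [and_comm, this, and_comm, @eq_comm _ a]
    simp only [h1]
    simp
  rw [h, ENNReal.toReal_sum]
  · refine Finset.sum_congr rfl fun S _ => ?_
    rw [ENNReal.toReal_mul, oracleMatch_eq_ite, leafWeight]
    congr 1
    split_ifs <;> simp
  · intro S _
    refine ENNReal.mul_ne_top (A.tsum_ite_ne_top _) ?_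
    split_ifs <;> simp

theorem PMF.sum_toReal {α : Type} [Fintype α] (p : PMF α) : ∑ a, (p a).toReal = 1 := by
  rw [← ENNReal.toReal_sum fun a _ => p.apply_ne_top a, ← tsum_fintype (L := .unconditional _),
    p.tsum_coe, ENNReal.toReal_one]

theorem PMF.toReal_bind_apply {α β : Type} [Fintype α] (p : PMF α) (f : α → PMF β) (b : β) :
    (p.bind f b).toReal = ∑ a, (p a).toReal * (f a b).toReal := by
  rw [PMF.bind_apply, tsum_fintype, ENNReal.toReal_sum]
  · simp only [ENNReal.toReal_mul]
  · exact fun a _ => ENNReal.mul_ne_top (p.apply_ne_top a) ((f a).apply_ne_top b)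

theorem isLeafWeight_leafWeight {κ : ℕ} {α : Type} [Fintype α] (A : RandAlg κ α) {Q : ℕ}
    (hA : A.QueriesAtMost Q) : IsLeafWeight (leafWeight A) Q where
  nonneg a S := ENNReal.toReal_nonneg
  sum_eq_one R := by
    simp only [← toReal_run_eq_sum]
    exact PMF.sum_toReal _
  size_le a S h := by
    classical
    contrapose! h
    rw [leafWeight]
    refine (ENNReal.toReal_eq_zero_iff _).2 (Or.inl (ENNReal.tsum_eq_zero.2 fun t => ?_))
    split_ifs with ht
    · obtain ⟨R, rfl, rfl⟩ := ht
      by_contra h0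
      exact absurd (hA t ((PMF.mem_support_iff _ _).2 h0) R)
        (not_le.2 (h.trans_le (QueryAlg.size_trace_le R t)))
    · rfl

theorem toReal_iidSamples {α : Type} [Fintype α] (p : PMF α) (m : ℕ) (x : Fin m → α) :
    (iidSamples p m x).toReal = ∏ i, (p (x i)).toReal := by
  simp [iidSamples, ENNReal.toReal_prod]

/-- The probability that the `ρ`-noise channel maps `x` to `y`. -/
def noiseKernel (ρ : ℝ) {n : ℕ} (x y : BitString n) : ℝ :=
  ∏ i, if x i = y i then (1 + ρ) / 2 else (1 - ρ) / 2

theorem toReal_noise (ρ : unitInterval) {n : ℕ} (x y : BitString n) :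
    (noise ρ x y).toReal = noiseKernel ρ x y := by
  classical
  rw [noise, PMF.map_apply, tsum_eq_single fun i => xor (x i) (y i)]
  · rw [if_pos (by ext i; simp), toReal_iidSamples, noiseKernel]
    refine Finset.prod_congr rfl fun i _ => ?_
    have h0 : 0 ≤ (1 - (ρ : ℝ)) / 2 := by linarith [ρ.2.2]
    have h1 : (flipProb ρ : ℝ) = (1 - ρ) / 2 := Real.coe_toNNReal _ h0
    have h2 : (flipProb ρ : ENNReal) ≤ 1 := by exact_mod_cast flipProb_le_one ρ
    by_cases h : x i = y i
    · simp only [h, Bool.xor_self, if_true, bitError, PMF.ofFintype_apply]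
      simp only [Bool.false_eq_true, if_false]
      rw [ENNReal.toReal_sub_of_le h2 ENNReal.one_ne_top, ENNReal.coe_toReal, h1]
      simp
      ring
    · have h3 : (x i).xor (y i) = true := by
        revert h
        cases x i <;> cases y i <;> simp
      simp only [h, h3, if_false, bitError, PMF.ofFintype_apply, if_true, ENNReal.coe_toReal, h1]
  · intro e he
    rw [if_neg]
    rintro rfl
    exact he (by ext i; simp)

/-! ### Two-function hypercontractivity on the cube -/

/-- Both sides vanish at `t = 0`. The derivative of the difference is nonnegative since `(1 +
x)^(s-1)` and `(1 - x)^(s-1)` have product at least `1`, hence sum at least `2`. -/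
theorem two_mul_le_one_add_rpow_sub {s : ℝ} (hs0 : 0 ≤ s) (hs1 : s ≤ 1) {t : ℝ} (ht0 : 0 ≤ t)
    (ht1 : t ≤ 1) : 2 * s * t ≤ (1 + t) ^ s - (1 - t) ^ s := by
  let h : ℝ → ℝ := fun t => (1 + t) ^ s - (1 - t) ^ s - 2 * s * t
  have hd : ∀ x ∈ Set.Ioo (0 : ℝ) 1,
      HasDerivAt h (s * (1 + x) ^ (s - 1) + s * (1 - x) ^ (s - 1) - 2 * s) x := by
    intro x hx
    have h1 : HasDerivAt (fun t : ℝ => (1 + t) ^ s) (1 * s * (1 + x) ^ (s - 1)) x :=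
      ((hasDerivAt_id' x).const_add 1).rpow_const (Or.inl (by linarith [hx.1]))
    have h2 : HasDerivAt (fun t : ℝ => (1 - t) ^ s) (-1 * s * (1 - x) ^ (s - 1)) x :=
      ((hasDerivAt_id' x).const_sub 1).rpow_const (Or.inl (by linarith [hx.2]))
    have h3 := (h1.sub h2).sub ((hasDerivAt_id' x).const_mul (2 * s))
    refine h3.congr_deriv ?_
    ring
  have hm : MonotoneOn h (Set.Icc 0 1) := by
    apply monotoneOn_of_deriv_nonneg (convex_Icc 0 1)
    · have := Real.continuous_rpow_const hs0
      exact Continuous.continuousOn (((this.comp (by fun_prop : Continuous fun t : ℝ => 1 + t)).sub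
        (this.comp (by fun_prop : Continuous fun t : ℝ => 1 - t))).sub (by fun_prop))
    · rw [interior_Icc]
      exact fun x hx => (hd x hx).differentiableAt.differentiableWithinAt
    · rw [interior_Icc]
      intro x hx
      rw [(hd x hx).deriv]
      have hA : 0 < 1 + x := by linarith [hx.1]
      have hB : 0 < 1 - x := by linarith [hx.2]
      have key : 2 ≤ (1 + x) ^ (s - 1) + (1 - x) ^ (s - 1) := by
        have hp : 1 ≤ (1 + x) ^ (s - 1) * (1 - x) ^ (s - 1) := by
          rw [← Real.mul_rpow hA.le hB.le]
          exact Real.one_le_rpow_of_pos_of_le_one_of_nonpos (by positivity)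
            (by linarith [sq_nonneg x, show (1 + x) * (1 - x) = 1 - x ^ 2 by ring]) (by linarith)
        nlinarith [sq_nonneg ((1 + x) ^ (s - 1) - (1 - x) ^ (s - 1)),
          Real.rpow_pos_of_pos hA (s - 1), Real.rpow_pos_of_pos hB (s - 1)]
      nlinarith
  have := hm ⟨le_rfl, zero_le_one⟩ ⟨ht0, ht1⟩ ht0
  simp only [h] at this
  simp at this
  linarith

theorem one_add_sq_le_rpow_mean {s : ℝ} (hs0 : 0 ≤ s) (hs1 : s ≤ 1) {t : ℝ} (ht0 : 0 ≤ t)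
    (ht1 : t ≤ 1) :
    1 + (1 + s) * s / 2 * t ^ 2 ≤ ((1 + t) ^ (1 + s) + (1 - t) ^ (1 + s)) / 2 := by
  let h : ℝ → ℝ := fun t => ((1 + t) ^ (1 + s) + (1 - t) ^ (1 + s)) / 2 - (1 + s) * s / 2 * t ^ 2
  have hd : ∀ x ∈ Set.Ioo (0 : ℝ) 1,
      HasDerivAt h ((1 + s) / 2 * ((1 + x) ^ s - (1 - x) ^ s - 2 * s * x)) x := by
    intro x hx
    have h1 : HasDerivAt (fun t : ℝ => (1 + t) ^ (1 + s)) (1 * (1 + s) * (1 + x) ^ (1 + s - 1)) x :=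
      ((hasDerivAt_id' x).const_add 1).rpow_const (Or.inl (by linarith [hx.1]))
    have h2 : HasDerivAt (fun t : ℝ => (1 - t) ^ (1 + s))
        (-1 * (1 + s) * (1 - x) ^ (1 + s - 1)) x :=
      ((hasDerivAt_id' x).const_sub 1).rpow_const (Or.inl (by linarith [hx.2]))
    have h3 := ((h1.add h2).div_const 2).sub
      (((hasDerivAt_id' x).pow 2).const_mul ((1 + s) * s / 2))
    refine h3.congr_deriv ?_
    rw [add_sub_cancel_left]
    push_cast
    ring
  have hm : MonotoneOn h (Set.Icc 0 1) := by
    apply monotoneOn_of_deriv_nonneg (convex_Icc 0 1)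
    · have := Real.continuous_rpow_const (show 0 ≤ 1 + s by linarith)
      exact Continuous.continuousOn
        ((((this.comp (by fun_prop : Continuous fun t : ℝ => 1 + t)).add
        (this.comp (by fun_prop : Continuous fun t : ℝ => 1 - t))).div_const 2).sub (by fun_prop))
    · rw [interior_Icc]
      exact fun x hx => (hd x hx).differentiableAt.differentiableWithinAt
    · rw [interior_Icc]
      intro x hx
      rw [(hd x hx).deriv]
      have := two_mul_le_one_add_rpow_sub hs0 hs1 hx.1.le hx.2.le
      exact mul_nonneg (by linarith) (by linarith)
  have := hm ⟨le_rfl, zero_le_one⟩ ⟨ht0, ht1⟩ ht0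
  simp only [h] at this
  simp at this
  linarith

/-- This is Bonami's two-point inequality from `L^(1+ρ)` to `L^2` for the noise operator of
parameter `√ρ`. After scaling the mean to `1`, Bernoulli's inequality bounds `(1 + ρt²)^((1+ρ)/2)`
by `1 + (1+ρ)ρt²/2`, and `one_add_sq_le_rpow_mean` compares this with the mean of `(1 ± t)^(1+ρ)`.
-/
theorem sqrt_le_rpow_mean_of_le {ρ : ℝ} (h0 : 0 ≤ ρ) (h1 : ρ ≤ 1) {a b : ℝ} (hb : 0 ≤ b)
    (hab : b ≤ a) :
    √(((a + b) / 2) ^ 2 + ρ * ((a - b) / 2) ^ 2) ≤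
      ((a ^ (1 + ρ) + b ^ (1 + ρ)) / 2) ^ (1 / (1 + ρ)) := by
  have ha : 0 ≤ a := hb.trans hab
  have hp : 0 < 1 + ρ := by linarith
  rcases ha.eq_or_lt with rfl | ha'
  · have : b = 0 := le_antisymm hab hb
    subst this
    simp only [add_zero, sub_zero, zero_div, ne_eq, OfNat.ofNat_ne_zero, not_false_eq_true,
      zero_pow, mul_zero, Real.sqrt_zero]
    positivity
  set m := (a + b) / 2 with hm
  have hm0 : 0 < m := by positivity
  set t := (a - b) / 2 / m with ht
  have htm : (a - b) / 2 = m * t := by rw [ht]; field_simp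
  have ht0 : 0 ≤ t := div_nonneg (by linarith) hm0.le
  have ht1 : t ≤ 1 := by rw [ht, div_le_one hm0]; linarith
  have ea : a = m * (1 + t) := by rw [mul_add, ← htm, hm]; ring
  have eb : b = m * (1 - t) := by rw [mul_sub, ← htm, hm]; ring
  have hX : (a ^ (1 + ρ) + b ^ (1 + ρ)) / 2 =
      m ^ (1 + ρ) * (((1 + t) ^ (1 + ρ) + (1 - t) ^ (1 + ρ)) / 2) := by
    conv_lhs => rw [ea, eb]
    rw [Real.mul_rpow hm0.le (by linarith), Real.mul_rpow hm0.le (by linarith)]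
    ring
  have hs : √(m ^ 2 + ρ * ((a - b) / 2) ^ 2) = m * (1 + ρ * t ^ 2) ^ (1 / 2 : ℝ) := by
    rw [htm, ← Real.sqrt_eq_rpow, show m ^ 2 + ρ * (m * t) ^ 2 = m ^ 2 * (1 + ρ * t ^ 2) by ring,
      Real.sqrt_mul (by positivity), Real.sqrt_sq hm0.le]
  rw [hs, hX, Real.mul_rpow (by positivity)
    (div_nonneg (add_nonneg (Real.rpow_nonneg (by linarith) _) (Real.rpow_nonneg (by linarith) _))
      zero_le_two),
    ← Real.rpow_mul hm0.le, mul_one_div_cancel hp.ne', Real.rpow_one]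
  refine mul_le_mul_of_nonneg_left ?_ hm0.le
  have hB : (1 + ρ * t ^ 2) ^ ((1 + ρ) / 2) ≤ ((1 + t) ^ (1 + ρ) + (1 - t) ^ (1 + ρ)) / 2 := by
    refine (rpow_one_add_le_one_add_mul_self (by nlinarith [sq_nonneg t]) (by linarith)
      (by linarith)).trans ?_
    have := one_add_sq_le_rpow_mean h0 h1 ht0 ht1
    nlinarith
  calc (1 + ρ * t ^ 2) ^ (1 / 2 : ℝ) = ((1 + ρ * t ^ 2) ^ ((1 + ρ) / 2)) ^ (1 / (1 + ρ)) := by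
        rw [← Real.rpow_mul (by positivity)]
        congr 1
        field_simp
    _ ≤ _ := Real.rpow_le_rpow (by positivity) hB (by positivity)

theorem sqrt_le_rpow_mean {ρ : ℝ} (h0 : 0 ≤ ρ) (h1 : ρ ≤ 1) {a b : ℝ} (ha : 0 ≤ a) (hb : 0 ≤ b) :
    √(((a + b) / 2) ^ 2 + ρ * ((a - b) / 2) ^ 2) ≤
      ((a ^ (1 + ρ) + b ^ (1 + ρ)) / 2) ^ (1 / (1 + ρ)) := by
  rcases le_total b a with h | h
  · exact sqrt_le_rpow_mean_of_le h0 h1 hb h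
  · have := sqrt_le_rpow_mean_of_le h0 h1 ha h
    rw [add_comm a b, add_comm (a ^ _), show ((a - b) / 2) ^ 2 = ((b - a) / 2) ^ 2 by ring]
    exact this

/-- With means `m, m'` and half-differences `d, d'` the left side is `mm' + ρdd'`. Cauchy–Schwarz
splits it into the two square roots bounded by `sqrt_le_rpow_mean`. -/
theorem two_point_hypercontractive {ρ : ℝ} (h0 : 0 ≤ ρ) (h1 : ρ ≤ 1) {a b c d : ℝ} (ha : 0 ≤ a)
    (hb : 0 ≤ b) (hc : 0 ≤ c) (hd : 0 ≤ d) :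
    (1 + ρ) / 4 * (a * c + b * d) + (1 - ρ) / 4 * (a * d + b * c) ≤
      ((a ^ (1 + ρ) + b ^ (1 + ρ)) / 2) ^ (1 / (1 + ρ)) *
        ((c ^ (1 + ρ) + d ^ (1 + ρ)) / 2) ^ (1 / (1 + ρ)) := by
  refine le_trans ?_ (mul_le_mul (sqrt_le_rpow_mean h0 h1 ha hb) (sqrt_le_rpow_mean h0 h1 hc hd)
    (Real.sqrt_nonneg _) (by positivity))
  rw [← Real.sqrt_mul (by positivity)]
  apply Real.le_sqrt_of_sq_le
  nlinarith [mul_nonneg h0 (sq_nonneg ((a + b) / 2 * ((c - d) / 2) - (a - b) / 2 * ((c + d) / 2)))]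

theorem sum_bitString_succ {n : ℕ} (F : BitString (n + 1) → ℝ) :
    ∑ x, F x = ∑ b : Bool, ∑ x : BitString n, F (Fin.cons b x) := by
  rw [← (Fin.consEquiv fun _ : Fin (n + 1) => Bool).sum_comp, Fintype.sum_prod_type]
  rfl

theorem noiseKernel_cons (ρ : ℝ) {n : ℕ} (b b' : Bool) (x y : BitString n) :
    noiseKernel ρ (Fin.cons b x : BitString (n + 1)) (Fin.cons b' y) =
      (if b = b' then (1 + ρ) / 2 else (1 - ρ) / 2) * noiseKernel ρ x y := by
  simp [noiseKernel, Fin.prod_univ_succ]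

theorem noiseKernel_nonneg {ρ : ℝ} (h0 : 0 ≤ ρ) (h1 : ρ ≤ 1) {n : ℕ} (x y : BitString n) :
    0 ≤ noiseKernel ρ x y := by
  refine Finset.prod_nonneg fun i _ => ?_
  split_ifs <;> linarith

theorem noiseKernel_comm (ρ : ℝ) {n : ℕ} (x y : BitString n) :
    noiseKernel ρ x y = noiseKernel ρ y x := by
  simp only [noiseKernel, eq_comm]

theorem sum_noiseKernel (ρ : ℝ) {n : ℕ} (x : BitString n) : ∑ y, noiseKernel ρ x y = 1 := by
  unfold noiseKernel
  rw [sum_prod_eq_prod_sum fun i b => if x i = b then (1 + ρ) / 2 else (1 - ρ) / 2]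
  refine Finset.prod_eq_one fun i _ => ?_
  cases x i <;> simp <;> ring

/-- The inequality tensorises: the induction hypothesis is applied to each pair of slices with fixed
first bits, and the two-point case to the norms of the slices. -/
theorem two_function_hypercontractive {ρ : ℝ} (h0 : 0 ≤ ρ) (h1 : ρ ≤ 1) {n : ℕ}
    (f g : BitString n → ℝ) (hf : ∀ x, 0 ≤ f x) (hg : ∀ x, 0 ≤ g x) :
    ∑ x, ∑ y, (1 / 2) ^ n * noiseKernel ρ x y * (f x * g y) ≤
      ((1 / 2) ^ n * ∑ x, f x ^ (1 + ρ)) ^ (1 / (1 + ρ)) *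
        ((1 / 2) ^ n * ∑ x, g x ^ (1 + ρ)) ^ (1 / (1 + ρ)) := by
  have hp : 0 < 1 + ρ := by linarith
  have hpow : ∀ a : ℝ, 0 ≤ a → (a ^ (1 + ρ)) ^ (1 / (1 + ρ)) = a := fun a ha => by
    rw [← Real.rpow_mul ha, mul_one_div_cancel hp.ne', Real.rpow_one]
  have hpow' : ∀ a : ℝ, 0 ≤ a → (a ^ (1 / (1 + ρ))) ^ (1 + ρ) = a := fun a ha => by
    rw [← Real.rpow_mul ha, one_div_mul_cancel hp.ne', Real.rpow_one]
  induction n with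
  | zero =>
    simp only [pow_zero, one_mul, Fintype.sum_unique, hpow _ (hf _), hpow _ (hg _)]
    simp [noiseKernel]
  | succ n ih =>
    let F : Bool → ℝ := fun b =>
      ((1 / 2) ^ n * ∑ x : BitString n, f (Fin.cons b x) ^ (1 + ρ)) ^ (1 / (1 + ρ))
    let G : Bool → ℝ := fun b =>
      ((1 / 2) ^ n * ∑ x : BitString n, g (Fin.cons b x) ^ (1 + ρ)) ^ (1 / (1 + ρ))
    have hSf : ∀ b, 0 ≤ (1 / 2 : ℝ) ^ n * ∑ x : BitString n, f (Fin.cons b x) ^ (1 + ρ) := fun b =>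
      mul_nonneg (by positivity) (Finset.sum_nonneg fun x _ => Real.rpow_nonneg (hf _) _)
    have hSg : ∀ b, 0 ≤ (1 / 2 : ℝ) ^ n * ∑ x : BitString n, g (Fin.cons b x) ^ (1 + ρ) := fun b =>
      mul_nonneg (by positivity) (Finset.sum_nonneg fun x _ => Real.rpow_nonneg (hg _) _)
    have hF : ∀ b, 0 ≤ F b := fun b => Real.rpow_nonneg (hSf b) _
    have hG : ∀ b, 0 ≤ G b := fun b => Real.rpow_nonneg (hSg b) _
    have hstep : ∑ x, ∑ y, (1 / 2) ^ (n + 1) * noiseKernel ρ x y * (f x * g y) =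
        ∑ b : Bool, ∑ b' : Bool, (if b = b' then (1 + ρ) / 4 else (1 - ρ) / 4) *
          ∑ x : BitString n, ∑ y : BitString n, (1 / 2) ^ n * noiseKernel ρ x y *
            (f (Fin.cons b x) * g (Fin.cons b' y)) := by
      simp only [sum_bitString_succ, noiseKernel_cons]
      refine Finset.sum_congr rfl fun b _ => ?_
      rw [Finset.sum_comm]
      refine Finset.sum_congr rfl fun b' _ => ?_
      simp only [Finset.mul_sum]
      refine Finset.sum_congr rfl fun x _ => Finset.sum_congr rfl fun y _ => ?_
      split_ifs <;> ring
    have hle : ∀ b b', ∑ x : BitString n, ∑ y : BitString n, (1 / 2) ^ n * noiseKernel ρ x y *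
            (f (Fin.cons b x) * g (Fin.cons b' y)) ≤ F b * G b' := fun b b' =>
      ih _ _ (fun x => hf _) fun x => hg _
    have hfinal := two_point_hypercontractive h0 h1 (hF true) (hF false) (hG true) (hG false)
    simp only [F, G, hpow' _ (hSf _), hpow' _ (hSg _)] at hfinal
    rw [hstep]
    have e1 : (1 / 2 : ℝ) ^ (n + 1) * ∑ x, f x ^ (1 + ρ) =
        ((1 / 2) ^ n * ∑ x : BitString n, f (Fin.cons true x) ^ (1 + ρ) +
          (1 / 2) ^ n * ∑ x : BitString n, f (Fin.cons false x) ^ (1 + ρ)) / 2 := by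
      rw [sum_bitString_succ, Fintype.sum_bool]
      ring
    have e2 : (1 / 2 : ℝ) ^ (n + 1) * ∑ x, g x ^ (1 + ρ) =
        ((1 / 2) ^ n * ∑ x : BitString n, g (Fin.cons true x) ^ (1 + ρ) +
          (1 / 2) ^ n * ∑ x : BitString n, g (Fin.cons false x) ^ (1 + ρ)) / 2 := by
      rw [sum_bitString_succ, Fintype.sum_bool]
      ring
    rw [e1, e2]
    refine le_trans ?_ hfinal
    have hA : 0 ≤ (1 + ρ) / 4 := by linarith
    have hB : 0 ≤ (1 - ρ) / 4 := by linarith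
    have i1 := mul_le_mul_of_nonneg_left (hle true true) hA
    have i2 := mul_le_mul_of_nonneg_left (hle false false) hA
    have i3 := mul_le_mul_of_nonneg_left (hle true false) hB
    have i4 := mul_le_mul_of_nonneg_left (hle false true) hB
    simp only [Fintype.sum_bool, if_true, Bool.true_eq_false, Bool.false_eq_true, if_false]
    simp only [F, G] at i1 i2 i3 i4
    linarith

/-! ### Collisions between the queries of encoder and decoder -/

section Collision

set_option linter.unusedSectionVars false

variable {X α : Type} [Fintype X] [DecidableEq X] [Fintype α]

/-- The output law of a query algorithm on a random oracle extending `K`. -/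
def outProb (W : α → PartialOracle X → ℝ) (K : PartialOracle X) (a : α) : ℝ :=
  ∑ S, W a S * matchProb K S

/-- The probability that a query algorithm outputs `a` and asks `q` on a random oracle
extending `K`. -/
def outQueryProb (W : α → PartialOracle X → ℝ) (K : PartialOracle X) (q : X) (a : α) : ℝ :=
  ∑ S, W a S * matchProb K S * (if S q ≠ none then 1 else 0)

/-- The probability that a query algorithm asks `q` on a random oracle extending `K`. -/
def queryProb (W : α → PartialOracle X → ℝ) (K : PartialOracle X) (q : X) : ℝ :=
  ∑ a, outQueryProb W K q a

namespace IsLeafWeight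

variable {W : α → PartialOracle X → ℝ} {Q : ℕ}

theorem outProb_nonneg (hW : IsLeafWeight W Q) (K : PartialOracle X) (a : α) :
    0 ≤ outProb W K a :=
  Finset.sum_nonneg fun S _ => mul_nonneg (hW.nonneg a S) (matchProb_nonneg K S)

theorem outQueryProb_nonneg (hW : IsLeafWeight W Q) (K : PartialOracle X) (q : X) (a : α) :
    0 ≤ outQueryProb W K q a :=
  Finset.sum_nonneg fun S _ => mul_nonneg (mul_nonneg (hW.nonneg a S) (matchProb_nonneg K S))
    (by split_ifs <;> norm_num)

theorem outQueryProb_le (hW : IsLeafWeight W Q) (K : PartialOracle X) (q : X) (a : α) :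
    outQueryProb W K q a ≤ outProb W K a :=
  Finset.sum_le_sum fun S _ => mul_le_of_le_one_right
    (mul_nonneg (hW.nonneg a S) (matchProb_nonneg K S)) (by split_ifs <;> norm_num)

theorem queryProb_nonneg (hW : IsLeafWeight W Q) (K : PartialOracle X) (q : X) :
    0 ≤ queryProb W K q :=
  Finset.sum_nonneg fun a _ => hW.outQueryProb_nonneg K q a

theorem sum_outProb (hW : IsLeafWeight W Q) (K : PartialOracle X) : ∑ a, outProb W K a = 1 := by
  have h : ∑ a, outProb W K a = ∑ R, oracleProb K R * ∑ a, ∑ S, W a S * oracleMatch S R := by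
    simp only [outProb, matchProb, Finset.mul_sum]
    rw [Finset.sum_comm' (t' := Finset.univ) (s' := fun _ => Finset.univ) (by simp)]
    conv_rhs => rw [Finset.sum_comm]; enter [2, a]; rw [Finset.sum_comm]
    rw [Finset.sum_comm]
    refine Finset.sum_congr rfl fun a _ => Finset.sum_congr rfl fun S _ =>
      Finset.sum_congr rfl fun R _ => ?_
    ring
  rw [h]
  simp [hW.sum_eq_one, sum_oracleProb]

theorem queryProb_le_one (hW : IsLeafWeight W Q) (K : PartialOracle X) (q : X) :
    queryProb W K q ≤ 1 := by
  rw [← hW.sum_outProb K]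
  exact Finset.sum_le_sum fun a _ => hW.outQueryProb_le K q a

theorem sum_queryProb_le (hW : IsLeafWeight W Q) (K : PartialOracle X) :
    ∑ q, queryProb W K q ≤ Q := by
  have h1 : ∑ q, queryProb W K q = ∑ a, ∑ S, W a S * matchProb K S * (S.size : ℝ) := by
    simp only [queryProb, outQueryProb]
    rw [Finset.sum_comm]
    refine Finset.sum_congr rfl fun a _ => ?_
    rw [Finset.sum_comm]
    refine Finset.sum_congr rfl fun S _ => ?_
    rw [← Finset.mul_sum, PartialOracle.size, Finset.card_filter]
    push_cast
    rfl
  calc ∑ q, queryProb W K q ≤ ∑ a, ∑ S, W a S * matchProb K S * (Q : ℝ) := by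
        rw [h1]
        refine Finset.sum_le_sum fun a _ => Finset.sum_le_sum fun S _ => ?_
        by_cases h : W a S = 0
        · simp [h]
        · exact mul_le_mul_of_nonneg_left (by exact_mod_cast hW.size_le a S h)
            (mul_nonneg (hW.nonneg a S) (matchProb_nonneg K S))
    _ = Q := by
        simp only [← Finset.sum_mul]
        have := hW.sum_outProb K
        simp only [outProb] at this
        rw [this, one_mul]

end IsLeafWeight

/-- Two measures of equal total mass that agree off `C` also give `C` the same mass. Hence the
collision mass may be computed under the product law `w`. -/
theorem sum_le_add_of_eq_off {ι : Type} [Fintype ι] (u w : ι → ℝ) (hu : ∀ i, 0 ≤ u i)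
    (hw : ∀ i, 0 ≤ w i) (hsum : ∑ i, u i = ∑ i, w i) (C A : ι → Prop) [DecidablePred C]
    [DecidablePred A] (hC : ∀ i, ¬ C i → u i = w i) :
    ∑ i, (if A i then u i else 0) ≤ ∑ i, (if A i then w i else 0) + ∑ i, if C i then w i else 0 := by
  have h1 : ∑ i, (if C i then u i else 0) = ∑ i, if C i then w i else 0 := by
    have : ∑ i, (u i - w i) = ∑ i, ((if C i then u i else 0) - if C i then w i else 0) := by
      refine Finset.sum_congr rfl fun i _ => ?_
      split_ifs with h
      · rfl
      · simp [hC i h]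
    rw [Finset.sum_sub_distrib, Finset.sum_sub_distrib, hsum, sub_self] at this
    linarith
  rw [← h1, ← Finset.sum_add_distrib]
  refine Finset.sum_le_sum fun i _ => ?_
  have := hu i
  have := hw i
  by_cases hA : A i <;> by_cases h : C i <;> simp [*]

/-- With `τ` the set of oracles this expands an experiment with a common oracle; with `τ = Unit` it
expands the one with independent oracles. -/
theorem sum_comm_five {ι₁ ι₂ ι₃ ι₄ ι₅ : Type} [Fintype ι₁] [Fintype ι₂] [Fintype ι₃] [Fintype ι₄]
    [Fintype ι₅] {τ : Type} [Fintype τ] (p : τ → ℝ) (e : ι₁ → ι₂ → ℝ) (N : ι₁ → ι₃ → ℝ)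
    (d : ι₃ → ι₄ → ι₅ → ℝ) (s : ι₂ → τ → ℝ) (t : ι₅ → τ → ℝ) (φ : ι₄ → ℝ) :
    ∑ i : ι₁ × ι₂ × ι₃ × ι₄ × ι₅, e i.1 i.2.1 * N i.1 i.2.2.1 * d i.2.2.1 i.2.2.2.1 i.2.2.2.2 *
        φ i.2.2.2.1 * (∑ R, p R * (s i.2.1 R * t i.2.2.2.2 R)) =
      ∑ R, p R * ∑ c, (∑ S, e c S * s S R) * ∑ y, N c y * ∑ b, φ b * ∑ T, d y b T * t T R := by
  simp only [Finset.mul_sum, Finset.sum_mul]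
  rw [Finset.sum_comm]
  refine Finset.sum_congr rfl fun R _ => ?_
  simp only [Fintype.sum_prod_type]
  refine Finset.sum_congr rfl fun c _ => ?_
  rw [Finset.sum_comm]
  refine Finset.sum_congr rfl fun y _ => ?_
  rw [Finset.sum_comm]
  refine Finset.sum_congr rfl fun b _ => ?_
  rw [Finset.sum_comm]
  refine Finset.sum_congr rfl fun T _ => Finset.sum_congr rfl fun S _ => ?_
  ring

variable {n Q : ℕ} (We : BitString n → PartialOracle X → ℝ)
  (Wd : BitString n → Bool → PartialOracle X → ℝ) (ρ : ℝ) (K : PartialOracle X)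

/-- The probability that the decoder accepts a noisy codeword, for an oracle extending `K` that is
common to encoder and decoder. -/
def commonAccept : ℝ :=
  ∑ R, oracleProb K R * ∑ c, (∑ S, We c S * oracleMatch S R) *
    ∑ y, noiseKernel ρ c y * ∑ T, Wd y true T * oracleMatch T R

/-- The probability that the decoder accepts a noisy codeword, for independent oracles extending `K`
in encoder and decoder. -/
def separateAccept : ℝ :=
  ∑ c, outProb We K c * ∑ y, noiseKernel ρ c y * outProb (Wd y) K true

open Classical in
/-- The probability that encoder and decoder, with independent oracles extending `K`, ask a common
query outside `K`. -/
def collisionProb : ℝ :=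
  ∑ i : BitString n × PartialOracle X × BitString n × Bool × PartialOracle X,
    if Collide K i.2.1 i.2.2.2.2 then
      We i.1 i.2.1 * noiseKernel ρ i.1 i.2.2.1 * Wd i.2.2.1 i.2.2.2.1 i.2.2.2.2 *
        (matchProb K i.2.1 * matchProb K i.2.2.2.2) else 0

variable {We Wd ρ}

theorem sum_sum_indicator (φ : Bool → ℝ) :
    ∑ i : BitString n × PartialOracle X × BitString n × Bool × PartialOracle X,
      We i.1 i.2.1 * noiseKernel ρ i.1 i.2.2.1 * Wd i.2.2.1 i.2.2.2.1 i.2.2.2.2 *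
        φ i.2.2.2.1 * jointMatchProb K i.2.1 i.2.2.2.2 =
      ∑ R, oracleProb K R * ∑ c, (∑ S, We c S * oracleMatch S R) *
        ∑ y, noiseKernel ρ c y * ∑ b, φ b * ∑ T, Wd y b T * oracleMatch T R :=
  sum_comm_five (oracleProb K) We (noiseKernel ρ) Wd oracleMatch oracleMatch φ

theorem sum_prod_indicator (φ : Bool → ℝ) :
    ∑ i : BitString n × PartialOracle X × BitString n × Bool × PartialOracle X,
      We i.1 i.2.1 * noiseKernel ρ i.1 i.2.2.1 * Wd i.2.2.1 i.2.2.2.1 i.2.2.2.2 *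
        φ i.2.2.2.1 * (matchProb K i.2.1 * matchProb K i.2.2.2.2) =
      ∑ c, outProb We K c * ∑ y, noiseKernel ρ c y * ∑ b, φ b * outProb (Wd y) K b := by
  have := sum_comm_five (τ := Unit) (fun _ => 1) We (noiseKernel ρ) Wd (fun S _ => matchProb K S)
    (fun T _ => matchProb K T) φ
  simpa [outProb] using this

theorem commonAccept_le_add (h0 : 0 ≤ ρ) (h1 : ρ ≤ 1) {Q' : ℕ} (hWe : IsLeafWeight We Q)
    (hWd : ∀ y, IsLeafWeight (Wd y) Q') :
    commonAccept We Wd ρ K ≤ separateAccept We Wd ρ K + collisionProb We Wd ρ K := by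
  classical
  set v : BitString n × PartialOracle X × BitString n × Bool × PartialOracle X → ℝ := fun i =>
    We i.1 i.2.1 * noiseKernel ρ i.1 i.2.2.1 * Wd i.2.2.1 i.2.2.2.1 i.2.2.2.2 with hv
  have hv0 : ∀ i, 0 ≤ v i := fun i => mul_nonneg (mul_nonneg (hWe.nonneg _ _)
    (noiseKernel_nonneg h0 h1 _ _)) ((hWd _).nonneg _ _)
  have key := sum_le_add_of_eq_off (fun i => v i * jointMatchProb K i.2.1 i.2.2.2.2)
    (fun i => v i * (matchProb K i.2.1 * matchProb K i.2.2.2.2))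
    (fun i => mul_nonneg (hv0 i) (jointMatchProb_nonneg _ _ _))
    (fun i => mul_nonneg (hv0 i) (mul_nonneg (matchProb_nonneg _ _) (matchProb_nonneg _ _)))
    (by
      have e1 := sum_sum_indicator (We := We) (Wd := Wd) (ρ := ρ) K fun _ => 1
      have e2 := sum_prod_indicator (We := We) (Wd := Wd) (ρ := ρ) K fun _ => 1
      simp only [mul_one, one_mul] at e1 e2
      simp only [hv]
      rw [e1, e2]
      simp only [(hWd _).sum_eq_one, (hWd _).sum_outProb, mul_one, sum_noiseKernel,
        hWe.sum_eq_one, hWe.sum_outProb, sum_oracleProb])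
    (fun i => Collide K i.2.1 i.2.2.2.2) (fun i => i.2.2.2.1 = true)
    (fun i hi => by simp only [jointMatchProb_of_not_collide hi])
  have e1 := sum_sum_indicator (We := We) (Wd := Wd) (ρ := ρ) K fun b => if b = true then 1 else 0
  have e2 := sum_prod_indicator (We := We) (Wd := Wd) (ρ := ρ) K fun b => if b = true then 1 else 0
  simp only [mul_ite, mul_one, mul_zero, ite_mul, zero_mul, one_mul, Finset.sum_ite_eq',
    Finset.mem_univ, if_true] at e1 e2
  simp only [hv] at key
  rw [e1, e2] at key
  exact key

theorem commonAccept_le_mul (h0 : 0 ≤ ρ) (h1 : ρ ≤ 1) {Q' : ℕ} (hWe : IsLeafWeight We Q)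
    (hWd : ∀ y, IsLeafWeight (Wd y) Q') :
    commonAccept We Wd ρ K ≤ 2 ^ Q * separateAccept We Wd ρ K := by
  have e1 := sum_sum_indicator (We := We) (Wd := Wd) (ρ := ρ) K fun b => if b = true then 1 else 0
  have e2 := sum_prod_indicator (We := We) (Wd := Wd) (ρ := ρ) K fun b => if b = true then 1 else 0
  simp only [ite_mul, zero_mul, one_mul, Finset.sum_ite_eq', Finset.mem_univ, if_true] at e1 e2
  rw [commonAccept, separateAccept, ← e1, ← e2, Finset.mul_sum]
  refine Finset.sum_le_sum fun i _ => ?_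
  have hv0 : 0 ≤ We i.1 i.2.1 * noiseKernel ρ i.1 i.2.2.1 * Wd i.2.2.1 i.2.2.2.1 i.2.2.2.2 *
      (if i.2.2.2.1 = true then 1 else 0) := mul_nonneg (mul_nonneg (mul_nonneg (hWe.nonneg _ _)
    (noiseKernel_nonneg h0 h1 _ _)) ((hWd _).nonneg _ _)) (by split_ifs <;> norm_num)
  rw [mul_left_comm]
  by_cases hW : We i.1 i.2.1 = 0
  · simp [hW]
  refine mul_le_mul_of_nonneg_left ((jointMatchProb_le _ _ _).trans ?_) hv0
  refine mul_le_mul_of_nonneg_right ?_ (mul_nonneg (matchProb_nonneg _ _) (matchProb_nonneg _ _))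
  exact pow_le_pow_right₀ one_le_two (hWe.size_le _ _ hW)

end Collision

/-- The total variation distance of `p` from the uniform distribution, for a law `p`. -/
def uniformExcess {n : ℕ} (p : BitString n → ℝ) : ℝ := ∑ c, max (p c - (1 / 2) ^ n) 0

theorem uniformExcess_nonneg {n : ℕ} (p : BitString n → ℝ) : 0 ≤ uniformExcess p :=
  Finset.sum_nonneg fun _ _ => le_max_right _ _

/-! ### Acceptance and collisions when the codeword is close to uniform. -/

section Collision

set_option linter.unusedSectionVars false

variable {X : Type} [Fintype X] [DecidableEq X] {n Q : ℕ}
  {We : BitString n → PartialOracle X → ℝ} {Wd : BitString n → Bool → PartialOracle X → ℝ} {ρ : ℝ}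
  (K : PartialOracle X)

/-- Replacing the codeword by a uniform string costs at most the distance from uniform, because the
acceptance probability lies in `[0, 1]`. The symmetric noise kernel preserves the uniform law. -/
theorem separateAccept_le (h0 : 0 ≤ ρ) (h1 : ρ ≤ 1) (hWd : ∀ y, IsLeafWeight (Wd y) Q) :
    separateAccept We Wd ρ K ≤
      uniformExcess (outProb We K) + ∑ y, (1 / 2) ^ n * outProb (Wd y) K true := by
  have hout : ∀ y, outProb (Wd y) K true ≤ 1 := fun y => by
    rw [← (hWd y).sum_outProb K]
    exact Finset.single_le_sum (fun b _ => (hWd y).outProb_nonneg K b) (Finset.mem_univ true)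
  have hG0 : ∀ c, 0 ≤ ∑ y, noiseKernel ρ c y * outProb (Wd y) K true := fun c =>
    Finset.sum_nonneg fun y _ => mul_nonneg (noiseKernel_nonneg h0 h1 c y)
      ((hWd y).outProb_nonneg K true)
  have hG1 : ∀ c, ∑ y, noiseKernel ρ c y * outProb (Wd y) K true ≤ 1 := fun c => by
    rw [← sum_noiseKernel ρ c]
    exact Finset.sum_le_sum fun y _ => mul_le_of_le_one_right (noiseKernel_nonneg h0 h1 c y) (hout y)
  have hU : ∑ y, (1 / 2) ^ n * outProb (Wd y) K true =
      ∑ c, (1 / 2) ^ n * ∑ y, noiseKernel ρ c y * outProb (Wd y) K true := by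
    simp only [Finset.mul_sum]
    rw [Finset.sum_comm]
    refine Finset.sum_congr rfl fun y _ => ?_
    rw [← Finset.mul_sum, ← Finset.sum_mul]
    simp only [noiseKernel_comm ρ _ y, sum_noiseKernel, one_mul]
  rw [hU, separateAccept, uniformExcess, ← Finset.sum_add_distrib]
  refine Finset.sum_le_sum fun c _ => ?_
  nlinarith [hG0 c, hG1 c, le_max_left (outProb We K c - (1 / 2) ^ n) 0,
    le_max_right (outProb We K c - (1 / 2) ^ n) 0]

/-- Since `1/(1+ρ) ≥ 1/2 + (1-ρ)/4`, which amounts to `(1-ρ)² ≥ 0`, each term is at most `√(a b) *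
M^((1-ρ)/4)`. The square roots are summed by the inequality between arithmetic and geometric means.
-/
theorem sum_rpow_mul_rpow_le (h0 : 0 ≤ ρ) (h1 : ρ ≤ 1) {ι : Type} (s : Finset ι) (a b : ι → ℝ)
    (ha0 : ∀ i, 0 ≤ a i) (ha1 : ∀ i, a i ≤ 1) (hb0 : ∀ i, 0 ≤ b i) (hb1 : ∀ i, b i ≤ 1)
    {M : ℝ} (hM0 : 0 ≤ M) (hM : ∀ i ∈ s, a i ≤ M) (ha : ∑ i ∈ s, a i ≤ Q) (hb : ∑ i ∈ s, b i ≤ Q) :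
    ∑ i ∈ s, a i ^ (1 / (1 + ρ)) * b i ^ (1 / (1 + ρ)) ≤ Q * M ^ ((1 - ρ) / 4) := by
  have hexp : 1 / 2 + (1 - ρ) / 4 ≤ 1 / (1 + ρ) := by
    rw [le_div_iff₀ (by linarith)]
    nlinarith
  have hi : ∀ i ∈ s, a i ^ (1 / (1 + ρ)) * b i ^ (1 / (1 + ρ)) ≤
      (a i + b i) / 2 * M ^ ((1 - ρ) / 4) := by
    intro i his
    have hMp : 0 ≤ M ^ ((1 - ρ) / 4) := Real.rpow_nonneg hM0 _
    have hra : a i ^ (1 / (1 + ρ)) ≤ √(a i) * M ^ ((1 - ρ) / 4) := by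
      calc a i ^ (1 / (1 + ρ)) ≤ a i ^ (1 / 2 + (1 - ρ) / 4) := by
            rcases (ha0 i).eq_or_lt with h | h
            · rw [← h, Real.zero_rpow (by positivity), Real.zero_rpow (by linarith)]
            · exact Real.rpow_le_rpow_of_exponent_ge h (ha1 i) hexp
        _ = √(a i) * a i ^ ((1 - ρ) / 4) := by
            rw [Real.rpow_add_of_nonneg (ha0 i) (by norm_num) (by linarith), Real.sqrt_eq_rpow]
        _ ≤ _ := mul_le_mul_of_nonneg_left
            (Real.rpow_le_rpow (ha0 i) (hM i his) (by linarith)) (Real.sqrt_nonneg _)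
    have hrb : b i ^ (1 / (1 + ρ)) ≤ √(b i) := by
      rw [Real.sqrt_eq_rpow]
      rcases (hb0 i).eq_or_lt with h | h
      · rw [← h, Real.zero_rpow (by positivity), Real.zero_rpow (by norm_num)]
      · exact Real.rpow_le_rpow_of_exponent_ge h (hb1 i) (by linarith)
    calc a i ^ (1 / (1 + ρ)) * b i ^ (1 / (1 + ρ))
        ≤ √(a i) * M ^ ((1 - ρ) / 4) * √(b i) :=
          mul_le_mul hra hrb (Real.rpow_nonneg (hb0 i) _) (by positivity)
      _ = √(a i) * √(b i) * M ^ ((1 - ρ) / 4) := by ring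
      _ ≤ _ := mul_le_mul_of_nonneg_right (by
          nlinarith [sq_nonneg (√(a i) - √(b i)), Real.sq_sqrt (ha0 i), Real.sq_sqrt (hb0 i)]) hMp
  refine (Finset.sum_le_sum hi).trans ?_
  rw [← Finset.sum_mul, ← Finset.sum_div, Finset.sum_add_distrib]
  exact mul_le_mul_of_nonneg_right (by linarith) (Real.rpow_nonneg hM0 _)

theorem sum_query_pair_le (h0 : 0 ≤ ρ) (h1 : ρ ≤ 1) (a b : BitString n → ℝ) (ha0 : ∀ x, 0 ≤ a x)
    (ha1 : ∀ x, a x ≤ 1) (hb0 : ∀ x, 0 ≤ b x) (hb1 : ∀ x, b x ≤ 1) :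
    ∑ x, ∑ y, (1 / 2) ^ n * noiseKernel ρ x y * (a x * b y) ≤
      ((1 / 2) ^ n * ∑ x, a x) ^ (1 / (1 + ρ)) * ((1 / 2) ^ n * ∑ x, b x) ^ (1 / (1 + ρ)) := by
  have hle : ∀ f : BitString n → ℝ, (∀ x, 0 ≤ f x) → (∀ x, f x ≤ 1) →
      ((1 / 2) ^ n * ∑ x, f x ^ (1 + ρ)) ^ (1 / (1 + ρ)) ≤
        ((1 / 2) ^ n * ∑ x, f x) ^ (1 / (1 + ρ)) := by
    intro f hf0 hf1
    refine Real.rpow_le_rpow (mul_nonneg (by positivity)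
      (Finset.sum_nonneg fun x _ => Real.rpow_nonneg (hf0 x) _)) ?_ (by positivity)
    refine mul_le_mul_of_nonneg_left (Finset.sum_le_sum fun x _ => ?_) (by positivity)
    exact Real.rpow_le_self_of_le_one (hf0 x) (hf1 x) (by linarith)
  have hnn : ∀ f : BitString n → ℝ, (∀ x, 0 ≤ f x) → 0 ≤ (1 / 2 : ℝ) ^ n * ∑ x, f x := fun f hf =>
    mul_nonneg (by positivity) (Finset.sum_nonneg fun x _ => hf x)
  exact (two_function_hypercontractive h0 h1 a b ha0 hb0).trans
    (mul_le_mul (hle a ha0 ha1) (hle b hb0 hb1)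
      (Real.rpow_nonneg (hnn _ fun x => Real.rpow_nonneg (hb0 x) _) _)
      (Real.rpow_nonneg (hnn a ha0) _))

/-- The factor `r` keeps part of the codeword law and the discarded mass is paid for in full. On the
kept part a union bound over the colliding query applies. -/
theorem collisionProb_le_sum (h0 : 0 ≤ ρ) (h1 : ρ ≤ 1) (hWe : IsLeafWeight We Q)
    (hWd : ∀ y, IsLeafWeight (Wd y) Q) (r : BitString n → ℝ) (hr0 : ∀ c, 0 ≤ r c)
    (hr1 : ∀ c, r c ≤ 1) :
    collisionProb We Wd ρ K ≤ ∑ c, (1 - r c) * outProb We K c +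
      ∑ q ∈ Finset.univ.filter fun q => K q = none,
        ∑ c, ∑ y, r c * outQueryProb We K q c * (noiseKernel ρ c y * queryProb (Wd y) K q) := by
  classical
  set v : BitString n × PartialOracle X × BitString n × Bool × PartialOracle X → ℝ := fun i =>
    We i.1 i.2.1 * noiseKernel ρ i.1 i.2.2.1 * Wd i.2.2.1 i.2.2.2.1 i.2.2.2.2 *
      (matchProb K i.2.1 * matchProb K i.2.2.2.2) with hv
  have hv0 : ∀ i, 0 ≤ v i := fun i => mul_nonneg (mul_nonneg (mul_nonneg (hWe.nonneg _ _)
    (noiseKernel_nonneg h0 h1 _ _)) ((hWd _).nonneg _ _))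
      (mul_nonneg (matchProb_nonneg _ _) (matchProb_nonneg _ _))
  have e1 : ∑ i, (1 - r i.1) * v i = ∑ c, (1 - r c) * outProb We K c := by
    have := sum_comm_five (τ := Unit) (fun _ => 1) (fun c S => (1 - r c) * We c S) (noiseKernel ρ)
      Wd (fun S _ => matchProb K S) (fun T _ => matchProb K T) fun _ => 1
    simp only [Finset.univ_unique, Finset.sum_const, Finset.card_singleton, one_smul, one_mul,
      mul_one] at this
    have h2 : ∀ y, ∑ b, ∑ T, Wd y b T * matchProb K T = 1 := fun y => (hWd y).sum_outProb K
    simp only [h2, mul_one, sum_noiseKernel] at this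
    simp only [hv, outProb, Finset.mul_sum]
    simp only [← mul_assoc] at this ⊢
    exact this
  have e2 : ∀ q, ∑ i, r i.1 * (v i * ((if i.2.1 q ≠ none then 1 else 0) *
      (if i.2.2.2.2 q ≠ none then 1 else 0))) =
      ∑ c, ∑ y, r c * outQueryProb We K q c * (noiseKernel ρ c y * queryProb (Wd y) K q) := by
    intro q
    have := sum_comm_five (τ := Unit) (fun _ => 1) (fun c S => r c * We c S) (noiseKernel ρ)
      Wd (fun S _ => matchProb K S * if S q ≠ none then 1 else 0)
      (fun T _ => matchProb K T * if T q ≠ none then 1 else 0) fun _ => 1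
    simp only [Finset.univ_unique, Finset.sum_const, Finset.card_singleton, one_smul, one_mul,
      mul_one] at this
    rw [Finset.sum_congr rfl fun i _ => ?_, this]
    · refine Finset.sum_congr rfl fun c _ => ?_
      simp only [queryProb, outQueryProb, Finset.mul_sum, Finset.sum_mul]
      simp only [← mul_assoc]
    · simp only [hv]
      ring
  rw [← e1]
  simp only [← e2]
  rw [Finset.sum_comm, ← Finset.sum_add_distrib, collisionProb]
  refine Finset.sum_le_sum fun i _ => ?_
  have hnn : ∀ q, 0 ≤ r i.1 * (v i * ((if i.2.1 q ≠ none then 1 else 0) *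
      (if i.2.2.2.2 q ≠ none then 1 else 0))) := fun q =>
    mul_nonneg (hr0 _) (mul_nonneg (hv0 i) (mul_nonneg (by split_ifs <;> norm_num)
      (by split_ifs <;> norm_num)))
  split_ifs with hC
  · obtain ⟨q, hq, hS, hT⟩ := hC
    have := Finset.single_le_sum (s := Finset.univ.filter fun q => K q = none) (fun q _ => hnn q)
      (Finset.mem_filter.2 ⟨Finset.mem_univ q, hq⟩)
    simp only [hS, hT, ne_eq, not_false_eq_true, if_true, mul_one] at this
    change v i ≤ _
    simp only [ne_eq] at this ⊢
    linarith
  · exact add_nonneg (mul_nonneg (by linarith [hr1 i.1]) (hv0 i))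
      (Finset.sum_nonneg fun q _ => hnn q)

theorem collisionProb_le (h0 : 0 ≤ ρ) (h1 : ρ ≤ 1) (hWe : IsLeafWeight We Q)
    (hWd : ∀ y, IsLeafWeight (Wd y) Q) {M : ℝ} (hM0 : 0 ≤ M)
    (hM : ∀ q, K q = none → queryProb We K q ≤ M) :
    collisionProb We Wd ρ K ≤ uniformExcess (outProb We K) + Q * M ^ ((1 - ρ) / 4) := by
  set U : ℝ := (1 / 2) ^ n with hU
  have hU0 : 0 < U := by positivity
  have hP0 := hWe.outProb_nonneg K
  -- Truncating the codeword law at the uniform density discards exactly `uniformExcess`. The kept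
  -- part is dominated by the uniform law, so that hypercontractivity applies to functions with
  -- values in `[0, 1]`.
  set r : BitString n → ℝ := fun c => if outProb We K c ≤ U then 1 else U / outProb We K c with hr
  have hr0 : ∀ c, 0 ≤ r c := fun c => by
    simp only [hr]
    split_ifs
    · norm_num
    · exact div_nonneg hU0.le (hP0 c)
  have hr1 : ∀ c, r c ≤ 1 := fun c => by
    simp only [hr]
    split_ifs with h
    · exact le_rfl
    · exact div_le_one_of_le₀ (not_le.1 h).le (hP0 c)
  have hrP : ∀ c, r c * outProb We K c ≤ U := fun c => by
    simp only [hr]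
    split_ifs with h
    · linarith
    · rw [div_mul_cancel₀ _ (hU0.trans (not_le.1 h)).ne']
  refine (collisionProb_le_sum K h0 h1 hWe hWd r hr0 hr1).trans (add_le_add ?_ ?_)
  · refine Finset.sum_le_sum fun c _ => ?_
    simp only [hr]
    split_ifs with h
    · simp
    · rw [sub_mul, div_mul_cancel₀ _ (hU0.trans (not_le.1 h)).ne', one_mul]
      exact le_max_left _ _
  -- Here `a q` is the density, relative to uniform, of kept codewords whose encoder asks `q`. Its
  -- uniform mean is at most the encoder's probability of asking `q`.
  · let a : X → BitString n → ℝ := fun q c => r c * outQueryProb We K q c / U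
    have ha0 : ∀ q c, 0 ≤ a q c := fun q c =>
      div_nonneg (mul_nonneg (hr0 c) (hWe.outQueryProb_nonneg K q c)) hU0.le
    have ha1 : ∀ q c, a q c ≤ 1 := fun q c => div_le_one_of_le₀
      ((mul_le_mul_of_nonneg_left (hWe.outQueryProb_le K q c) (hr0 c)).trans (hrP c)) hU0.le
    have hq : ∀ q, ∑ c, ∑ y, r c * outQueryProb We K q c *
        (noiseKernel ρ c y * queryProb (Wd y) K q) ≤
        (U * ∑ c, a q c) ^ (1 / (1 + ρ)) * (U * ∑ y, queryProb (Wd y) K q) ^ (1 / (1 + ρ)) := by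
      intro q
      refine le_trans (le_of_eq ?_) (sum_query_pair_le h0 h1 (a q) (fun y => queryProb (Wd y) K q)
        (ha0 q) (ha1 q) (fun y => (hWd y).queryProb_nonneg K q)
        fun y => (hWd y).queryProb_le_one K q)
      refine Finset.sum_congr rfl fun c _ => Finset.sum_congr rfl fun y _ => ?_
      simp only [a, ← hU]
      field_simp
    have haq : ∀ q, U * ∑ c, a q c ≤ queryProb We K q := by
      intro q
      rw [Finset.mul_sum]
      refine Finset.sum_le_sum fun c _ => ?_
      simp only [a]
      rw [mul_div_cancel₀ _ hU0.ne']
      exact mul_le_of_le_one_left (hWe.outQueryProb_nonneg K q c) (hr1 c)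
    have hcard : U * ∑ _y : BitString n, (1 : ℝ) = 1 := by
      simp [hU]
    refine (Finset.sum_le_sum fun q _ => hq q).trans
      (sum_rpow_mul_rpow_le h0 h1 _ (fun q => U * ∑ c, a q c)
        (fun q => U * ∑ y, queryProb (Wd y) K q) (fun q => ?_) (fun q => ?_) (fun q => ?_)
        (fun q => ?_) hM0 (fun q hq => ?_) ?_ ?_)
    · exact mul_nonneg hU0.le (Finset.sum_nonneg fun c _ => ha0 q c)
    · exact (haq q).trans (hWe.queryProb_le_one K q)
    · exact mul_nonneg hU0.le (Finset.sum_nonneg fun y _ => (hWd y).queryProb_nonneg K q)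
    · rw [← hcard]
      exact mul_le_mul_of_nonneg_left
        (Finset.sum_le_sum fun y _ => (hWd y).queryProb_le_one K q) hU0.le
    · exact (haq q).trans (hM q (Finset.mem_filter.1 hq).2)
    · refine (Finset.sum_le_sum fun q _ => haq q).trans (le_trans ?_ (hWe.sum_queryProb_le K))
      exact Finset.sum_le_sum_of_subset_of_nonneg (Finset.filter_subset _ _)
        fun q _ _ => hWe.queryProb_nonneg K q
    · rw [← Finset.mul_sum, Finset.sum_comm]
      have : ∑ y, ∑ q ∈ Finset.univ.filter (fun q => K q = none), queryProb (Wd y) K q ≤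
          ∑ _y : BitString n, 1 * (Q : ℝ) := by
        refine Finset.sum_le_sum fun y _ => ?_
        rw [one_mul]
        exact (Finset.sum_le_sum_of_subset_of_nonneg (Finset.filter_subset _ _)
          fun q _ _ => (hWd y).queryProb_nonneg K q).trans ((hWd y).sum_queryProb_le K)
      refine (mul_le_mul_of_nonneg_left this hU0.le).trans ?_
      rw [← Finset.sum_mul, ← mul_assoc, hcard, one_mul]

end Collision

/-! ### Learning the heavy queries -/

section Learn

set_option linter.unusedSectionVars false

variable {X α : Type} [Fintype X] [DecidableEq X] [Fintype α]

theorem outQueryProb_eq_update (W : α → PartialOracle X → ℝ) (K : PartialOracle X) {q : X}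
    (hq : K q = none) (p : X) (a : α) :
    outQueryProb W K p a = ∑ b, 1 / 2 * outQueryProb W (Function.update K q (some b)) p a := by
  simp only [outQueryProb, matchProb_eq_update K _ hq, Finset.mul_sum, Finset.sum_mul]
  rw [Finset.sum_comm]
  refine Finset.sum_congr rfl fun b _ => Finset.sum_congr rfl fun S _ => ?_
  ring

theorem queryProb_eq_update (W : α → PartialOracle X → ℝ) (K : PartialOracle X) {q : X}
    (hq : K q = none) (p : X) :
    queryProb W K p = ∑ b, 1 / 2 * queryProb W (Function.update K q (some b)) p := by
  simp only [queryProb, outQueryProb_eq_update W K hq, Finset.mul_sum]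
  rw [Finset.sum_comm]

theorem exists_heaviest (W : α → PartialOracle X → ℝ) (K : PartialOracle X)
    (h : ∃ q, K q = none) :
    ∃ q, K q = none ∧ ∀ p, K p = none → queryProb W K p ≤ queryProb W K q := by
  obtain ⟨q0, h0⟩ := h
  obtain ⟨q, hq, hmax⟩ := (Finset.univ.filter fun q => K q = none).exists_max_image
    (queryProb W K) ⟨q0, by simpa using h0⟩
  exact ⟨q, by simpa using hq, fun p hp => hmax p (by simpa using hp)⟩

open Classical in
/-- The extension of `K` by the answer `b` to a query outside `K` that is asked with the largest
probability. -/
def learn (W : α → PartialOracle X → ℝ) (K : PartialOracle X) (b : Bool) : PartialOracle X :=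
  if h : ∃ q, K q = none then Function.update K (exists_heaviest W K h).choose (some b) else K

open Classical in
/-- The largest probability with which a query outside `K` is asked. -/
def heaviest (W : α → PartialOracle X → ℝ) (K : PartialOracle X) : ℝ :=
  if h : ∃ q, K q = none then queryProb W K (exists_heaviest W K h).choose else 0

/-- The expected number of distinct queries outside `K`. -/
def unknownQueries (W : α → PartialOracle X → ℝ) (K : PartialOracle X) : ℝ :=
  ∑ q, if K q = none then queryProb W K q else 0

theorem queryProb_le_heaviest (W : α → PartialOracle X → ℝ) (K : PartialOracle X) (q : X)
    (hq : K q = none) : queryProb W K q ≤ heaviest W K := by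
  have h : ∃ q, K q = none := ⟨q, hq⟩
  rw [heaviest, dif_pos h]
  exact (exists_heaviest W K h).choose_spec.2 q hq

theorem heaviest_nonneg {W : α → PartialOracle X → ℝ} {Q : ℕ} (hW : IsLeafWeight W Q)
    (K : PartialOracle X) : 0 ≤ heaviest W K := by
  rw [heaviest]
  split_ifs
  · exact hW.queryProb_nonneg _ _
  · exact le_rfl

theorem oracleProb_eq_learn (W : α → PartialOracle X → ℝ) (K : PartialOracle X) (R : X → Bool) :
    oracleProb K R = ∑ b, 1 / 2 * oracleProb (learn W K b) R := by
  by_cases h : ∃ q, K q = none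
  · simp only [learn, dif_pos h]
    exact oracleProb_eq_update K (exists_heaviest W K h).choose_spec.1 R
  · simp only [learn, dif_neg h, Fintype.sum_bool]
    ring

theorem size_learn_le (W : α → PartialOracle X → ℝ) (K : PartialOracle X) (b : Bool) :
    (learn W K b).size ≤ K.size + 1 := by
  rw [learn]
  split_ifs
  · exact K.size_update_le _ _
  · exact Nat.le_succ _

/-- Revealing a fair answer leaves the query probabilities unchanged on average, so the only
expected loss is the term of the revealed query. -/
theorem sum_unknownQueries_learn (W : α → PartialOracle X → ℝ) (K : PartialOracle X) :
    ∑ b, 1 / 2 * unknownQueries W (learn W K b) = unknownQueries W K - heaviest W K := by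
  by_cases h : ∃ q, K q = none
  · simp only [learn, heaviest, dif_pos h]
    set q := (exists_heaviest W K h).choose
    have hq : K q = none := (exists_heaviest W K h).choose_spec.1
    simp only [unknownQueries, Finset.mul_sum]
    rw [Finset.sum_comm, ← Finset.sum_erase_add _ _ (Finset.mem_univ q),
      ← Finset.sum_erase_add _ (fun p => if K p = none then queryProb W K p else 0)
        (Finset.mem_univ q)]
    simp only [Function.update_self, reduceCtorEq, if_false, mul_zero, Finset.sum_const_zero,
      add_zero, hq, if_true, add_sub_cancel_right]
    refine Finset.sum_congr rfl fun p hp => ?_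
    simp only [Function.update_of_ne (Finset.ne_of_mem_erase hp)]
    split_ifs
    · exact (queryProb_eq_update W K hq p).symm
    · simp
  · simp only [learn, heaviest, dif_neg h, Fintype.sum_bool]
    ring

theorem unknownQueries_nonneg {W : α → PartialOracle X → ℝ} {Q : ℕ} (hW : IsLeafWeight W Q)
    (K : PartialOracle X) : 0 ≤ unknownQueries W K :=
  Finset.sum_nonneg fun q _ => by
    split_ifs
    · exact hW.queryProb_nonneg K q
    · exact le_rfl

theorem unknownQueries_le {W : α → PartialOracle X → ℝ} {Q : ℕ} (hW : IsLeafWeight W Q)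
    (K : PartialOracle X) : unknownQueries W K ≤ Q := by
  refine (Finset.sum_le_sum fun q _ => ?_).trans (hW.sum_queryProb_le K)
  split_ifs
  · exact le_rfl
  · exact hW.queryProb_nonneg K q

open Classical in
/-- The law of the partial oracle after the heaviest query has been learned. -/
def learnStep (W : α → PartialOracle X → ℝ) (w : PartialOracle X → ℝ) (K' : PartialOracle X) : ℝ :=
  ∑ K, ∑ b, if learn W K b = K' then w K * (1 / 2) else 0

theorem sum_learnStep_mul (W : α → PartialOracle X → ℝ) (w f : PartialOracle X → ℝ) :
    ∑ K, learnStep W w K * f K = ∑ K, w K * ∑ b, 1 / 2 * f (learn W K b) := by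
  simp only [learnStep, Finset.sum_mul]
  rw [Finset.sum_comm]
  refine Finset.sum_congr rfl fun K _ => ?_
  rw [Finset.sum_comm, Finset.mul_sum]
  refine Finset.sum_congr rfl fun b _ => ?_
  simp only [ite_mul, zero_mul, Finset.sum_ite_eq, Finset.mem_univ, if_true]
  ring

theorem learnStep_nonneg (W : α → PartialOracle X → ℝ) {w : PartialOracle X → ℝ}
    (hw : ∀ K, 0 ≤ w K) (K : PartialOracle X) : 0 ≤ learnStep W w K :=
  Finset.sum_nonneg fun K _ => Finset.sum_nonneg fun b _ => by
    have := hw K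
    split_ifs <;> positivity

theorem exists_of_learnStep_ne_zero (W : α → PartialOracle X → ℝ) {w : PartialOracle X → ℝ}
    {K' : PartialOracle X} (h : learnStep W w K' ≠ 0) : ∃ K b, w K ≠ 0 ∧ learn W K b = K' := by
  obtain ⟨K, _, h⟩ := Finset.exists_ne_zero_of_sum_ne_zero h
  obtain ⟨b, _, h⟩ := Finset.exists_ne_zero_of_sum_ne_zero h
  split_ifs at h with hK
  · exact ⟨K, b, left_ne_zero_of_mul h, hK⟩
  · exact absurd rfl h

/-- After learning at most `D` answers, all remaining queries are light on average. -/
theorem exists_light_extension {σ : Type} [Fintype σ] {Q : ℕ} (W : σ → α → PartialOracle X → ℝ)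
    (hW : ∀ s, IsLeafWeight (W s) Q) (w₀ : σ → PartialOracle X → ℝ) (hw₀ : ∀ s K, 0 ≤ w₀ s K)
    (hsum : ∑ s, ∑ K, w₀ s K = 1) {Q₀ : ℕ} (hsize : ∀ s K, w₀ s K ≠ 0 → K.size ≤ Q₀) {D : ℕ}
    (hD : 0 < D) :
    ∃ w : σ → PartialOracle X → ℝ, (∀ s K, 0 ≤ w s K) ∧
      (∀ s R, ∑ K, w s K * oracleProb K R = ∑ K, w₀ s K * oracleProb K R) ∧
      (∀ s K, w s K ≠ 0 → K.size ≤ Q₀ + D) ∧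
      ∑ s, ∑ K, w s K * heaviest (W s) K ≤ Q / D := by
  let v : ℕ → σ → PartialOracle X → ℝ := fun i s => (learnStep (W s))^[i] (w₀ s)
  have hv : ∀ i s, v (i + 1) s = learnStep (W s) (v i s) := fun i s =>
    Function.iterate_succ_apply' _ _ _
  have hnn : ∀ i s K, 0 ≤ v i s K := by
    intro i
    induction i with
    | zero => exact hw₀
    | succ i ih => exact fun s K => by rw [hv]; exact learnStep_nonneg _ (ih s) K
  have hlaw : ∀ i s R, ∑ K, v i s K * oracleProb K R = ∑ K, w₀ s K * oracleProb K R := by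
    intro i
    induction i with
    | zero => exact fun s R => rfl
    | succ i ih =>
      intro s R
      rw [hv, sum_learnStep_mul, ← ih]
      simp only [← oracleProb_eq_learn]
  have hsz : ∀ i s K, v i s K ≠ 0 → K.size ≤ Q₀ + i := by
    intro i
    induction i with
    | zero => exact hsize
    | succ i ih =>
      intro s K h
      rw [hv] at h
      obtain ⟨K, b, h1, rfl⟩ := exists_of_learnStep_ne_zero _ h
      exact (size_learn_le _ _ _).trans (Nat.succ_le_succ (ih s K h1))
  have hphi : ∀ i, ∑ s, ∑ K, v i s K * heaviest (W s) K =
      ∑ s, ∑ K, v i s K * unknownQueries (W s) K -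
        ∑ s, ∑ K, v (i + 1) s K * unknownQueries (W s) K := by
    intro i
    simp only [hv, sum_learnStep_mul, sum_unknownQueries_learn, ← Finset.sum_sub_distrib]
    refine Finset.sum_congr rfl fun s _ => Finset.sum_congr rfl fun K _ => ?_
    ring
  have htot : ∑ i ∈ Finset.range D, ∑ s, ∑ K, v i s K * heaviest (W s) K ≤
      ∑ _i ∈ Finset.range D, (Q : ℝ) / D := by
    rw [Finset.sum_congr rfl fun i _ => hphi i, Finset.sum_range_sub']
    have hle : ∑ s, ∑ K, v 0 s K * unknownQueries (W s) K ≤ Q := by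
      calc ∑ s, ∑ K, v 0 s K * unknownQueries (W s) K ≤ ∑ s, ∑ K, w₀ s K * (Q : ℝ) :=
            Finset.sum_le_sum fun s _ => Finset.sum_le_sum fun K _ =>
              mul_le_mul_of_nonneg_left (unknownQueries_le (hW s) K) (hw₀ s K)
        _ = Q := by simp only [← Finset.sum_mul, hsum, one_mul]
    have hge : 0 ≤ ∑ s, ∑ K, v D s K * unknownQueries (W s) K :=
      Finset.sum_nonneg fun s _ => Finset.sum_nonneg fun K _ =>
        mul_nonneg (hnn D s K) (unknownQueries_nonneg (hW s) K)
    have hD' : (D : ℝ) ≠ 0 := by exact_mod_cast hD.ne'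
    rw [Finset.sum_const, Finset.card_range, nsmul_eq_mul, mul_div_cancel₀ _ hD']
    linarith
  -- The potential drops telescope to at most `Q` over `D` steps, so some stage is at most average.
  -- Stopping there for all keys simultaneously is enough.
  obtain ⟨i, hi, hle⟩ := Finset.exists_le_of_sum_le ⟨0, Finset.mem_range.2 hD⟩ htot
  exact ⟨v i, hnn i, hlaw i, fun s K h => (hsz i s K h).trans
    (Nat.add_le_add_left (Finset.mem_range.1 hi).le _), hle⟩

end Learn

/-! ### The distinguisher with many samples -/

section Samples

variable {Y : Type} [Fintype Y]

/-- From `exp x ≤ 1 + x + x²` for `|x| ≤ 1`; the linear term has mean zero. -/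
theorem sum_mul_exp_le {u : ℝ} (hu : 0 ≤ u) (hu1 : ∑ _y : Y, u = 1) {g : Y → ℝ}
    (hg : ∀ y, |g y| ≤ 1) (hg0 : ∑ y, u * g y = 0) {s : ℝ} (hs0 : 0 ≤ s) (hs1 : s ≤ 1) :
    ∑ y, u * Real.exp (s * g y) ≤ Real.exp (s ^ 2) := by
  have h1 : ∀ y, u * Real.exp (s * g y) ≤ u + s * (u * g y) + u * s ^ 2 := by
    intro y
    have hab : |s * g y| ≤ 1 := by
      rw [abs_mul, abs_of_nonneg hs0]
      exact mul_le_one₀ hs1 (abs_nonneg _) (hg y)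
    have h2 := (abs_le.1 (Real.abs_exp_sub_one_sub_id_le hab)).2
    have h3 : (s * g y) ^ 2 ≤ s ^ 2 := by
      rw [mul_pow]
      exact mul_le_of_le_one_right (sq_nonneg s) ((sq_le_one_iff_abs_le_one _).2 (hg y))
    nlinarith
  refine (Finset.sum_le_sum fun y _ => h1 y).trans ?_
  rw [Finset.sum_add_distrib, Finset.sum_add_distrib, ← Finset.mul_sum, hg0, ← Finset.sum_mul, hu1]
  linarith [Real.add_one_le_exp (s ^ 2)]

theorem sum_pi_exp_le {u : ℝ} (hu : 0 ≤ u) (hu1 : ∑ _y : Y, u = 1) {g : Y → ℝ}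
    (hg : ∀ y, |g y| ≤ 1) (hg0 : ∑ y, u * g y = 0) {s : ℝ} (hs0 : 0 ≤ s) (hs1 : s ≤ 1) (m : ℕ) :
    ∑ c : Fin m → Y, u ^ m * Real.exp (s * ∑ i, g (c i)) ≤ Real.exp (s ^ 2 * m) := by
  have h : ∀ c : Fin m → Y, u ^ m * Real.exp (s * ∑ i, g (c i)) =
      ∏ i, u * Real.exp (s * g (c i)) := by
    intro c
    rw [Finset.prod_mul_distrib, ← Real.exp_sum, Finset.mul_sum]
    simp
  simp only [h]
  rw [sum_prod_eq_prod_sum fun _ y => u * Real.exp (s * g y), mul_comm, Real.exp_nat_mul]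
  simp only [Finset.prod_const, Finset.card_univ, Fintype.card_fin]
  exact pow_le_pow_left₀ (Finset.sum_nonneg fun y _ => by positivity)
    (sum_mul_exp_le hu hu1 hg hg0 hs0 hs1) m

theorem sum_pi_const (u : ℝ) (hu1 : ∑ _y : Y, u = 1) (m : ℕ) : ∑ _c : Fin m → Y, u ^ m = 1 := by
  have := sum_prod_eq_prod_sum (X := Fin m) fun _ (_ : Y) => u
  simpa [hu1] using this

/-- Under the uniform law, the largest of few empirical averages is small in expectation. -/
theorem exists_max_average {ζ : Type} (Z : Finset ζ) (hZ : Z.Nonempty) {u : ℝ} (hu : 0 ≤ u)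
    (hu1 : ∑ _y : Y, u = 1) (g : ζ → Y → ℝ) (hg : ∀ z y, |g z y| ≤ 1)
    (hg0 : ∀ z, ∑ y, u * g z y = 0) {s : ℝ} (hs0 : 0 < s) (hs1 : s ≤ 1) {m : ℕ} (hm : 0 < m)
    (hcard : (Z.card : ℝ) ≤ Real.exp (s ^ 2 * m)) :
    ∃ h : (Fin m → Y) → ℝ, (∀ c, |h c| ≤ 1) ∧ (∀ z ∈ Z, ∀ c, (∑ i, g z (c i)) / m ≤ h c) ∧
      ∑ c, u ^ m * h c ≤ 2 * s := by
  have hm' : (0 : ℝ) < m := by exact_mod_cast hm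
  let H : (Fin m → Y) → ℝ := fun c => Z.sup' hZ fun z => ∑ i, g z (c i)
  have habs : ∀ z, ∀ c : Fin m → Y, |∑ i, g z (c i)| ≤ m := fun z c => by
    refine (Finset.abs_sum_le_sum_abs _ _).trans ((Finset.sum_le_sum fun i _ => hg z (c i)).trans ?_)
    simp
  have hH : ∀ c, ∃ z ∈ Z, H c = ∑ i, g z (c i) := fun c => Finset.exists_mem_eq_sup' hZ _
  refine ⟨fun c => H c / m, fun c => ?_, fun z hz c => ?_, ?_⟩
  · obtain ⟨z, _, hz⟩ := hH c
    change |H c / m| ≤ 1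
    rw [hz, abs_div, abs_of_pos hm', div_le_one hm']
    exact habs z c
  · exact div_le_div_of_nonneg_right (Finset.le_sup' (fun z => ∑ i, g z (c i)) hz) hm'.le
  -- Exponential moment with a union bound over `Z`: one factor `exp (s² m)` is the moment of a
  -- single sum, the other is the cardinality.
  · have hexp : ∑ c, u ^ m * Real.exp (s * H c) ≤ Real.exp (2 * (s ^ 2 * m)) := by
      calc ∑ c, u ^ m * Real.exp (s * H c)
          ≤ ∑ c : Fin m → Y, ∑ z ∈ Z, u ^ m * Real.exp (s * ∑ i, g z (c i)) := by
            refine Finset.sum_le_sum fun c _ => ?_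
            obtain ⟨z, hzZ, hz⟩ := hH c
            rw [hz]
            exact Finset.single_le_sum
              (f := fun z => u ^ m * Real.exp (s * ∑ i, g z (c i)))
              (fun z _ => by positivity) hzZ
        _ ≤ ∑ z ∈ Z, Real.exp (s ^ 2 * m) := by
            rw [Finset.sum_comm]
            exact Finset.sum_le_sum fun z _ => sum_pi_exp_le hu hu1 (hg z) (hg0 z) hs0.le hs1 m
        _ ≤ Real.exp (s ^ 2 * m) * Real.exp (s ^ 2 * m) := by
            rw [Finset.sum_const, nsmul_eq_mul]
            exact mul_le_mul_of_nonneg_right hcard (Real.exp_pos _).le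
        _ = _ := by rw [← Real.exp_add]; ring_nf
    -- Jensen's inequality for the exponential, through its tangent line at `2 s² m`.
    have hlin : ∑ c, u ^ m * (s * H c) ≤ 2 * (s ^ 2 * m) := by
      have h1 : ∀ c, u ^ m * (s * H c) ≤ u ^ m * (2 * (s ^ 2 * m) - 1) +
          Real.exp (-(2 * (s ^ 2 * m))) * (u ^ m * Real.exp (s * H c)) := fun c => by
        have := Real.add_one_le_exp (s * H c - 2 * (s ^ 2 * m))
        rw [sub_eq_add_neg, Real.exp_add] at this
        nlinarith [pow_nonneg hu m]
      refine (Finset.sum_le_sum fun c _ => h1 c).trans ?_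
      rw [Finset.sum_add_distrib, ← Finset.sum_mul, ← Finset.mul_sum, sum_pi_const u hu1, one_mul]
      have := mul_le_mul_of_nonneg_left hexp (Real.exp_pos (-(2 * (s ^ 2 * m)))).le
      rw [← Real.exp_add, neg_add_cancel, Real.exp_zero] at this
      linarith
    have h2 : ∑ c, u ^ m * (s * H c) = s * m * ∑ c, u ^ m * (H c / m) := by
      rw [Finset.mul_sum]
      refine Finset.sum_congr rfl fun c _ => ?_
      field_simp
    rw [h2] at hlin
    have h3 : 0 < s * m := by positivity
    refine le_of_mul_le_mul_left (a := s * m) ?_ h3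
    linarith

theorem sum_pi_mul_apply {p : Y → ℝ} (hp : ∑ y, p y = 1) {m : ℕ} (f : Y → ℝ) (j : Fin m) :
    ∑ c : Fin m → Y, (∏ i, p (c i)) * f (c j) = ∑ y, p y * f y := by
  have h : ∀ c : Fin m → Y, (∏ i, p (c i)) * f (c j) =
      ∏ i, p (c i) * (if i = j then f (c i) else 1) := by
    intro c
    rw [Finset.prod_mul_distrib]
    congr 1
    simp
  simp only [h]
  rw [sum_prod_eq_prod_sum fun i y => p y * if i = j then f y else 1,
    Finset.prod_eq_single j]
  · simp
  · intro i _ hi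
    simp [hi, hp]
  · simp

theorem sum_pi_mul_average {p : Y → ℝ} (hp : ∑ y, p y = 1) {m : ℕ} (hm : 0 < m) (f : Y → ℝ) :
    ∑ c : Fin m → Y, (∏ i, p (c i)) * ((∑ i, f (c i)) / m) = ∑ y, p y * f y := by
  have hm' : (m : ℝ) ≠ 0 := by exact_mod_cast hm.ne'
  simp only [Finset.sum_div, Finset.mul_sum]
  rw [Finset.sum_comm]
  simp only [← mul_div_assoc, ← Finset.sum_div, sum_pi_mul_apply hp]
  simp
  field_simp

end Samples

/-- A statistic of many samples whose expectation is small for uniform samples and is at least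
the average distance from uniform of the conditional law of one sample, for conditional laws with
few possible values of the condition. -/
theorem exists_statistic {ζ τ : Type} [Fintype ζ] [Fintype τ] {n : ℕ} (Z : Finset ζ)
    (hZ : Z.Nonempty) (w : ζ → ℝ) (hw : ∀ z, 0 ≤ w z) (hwZ : ∀ z, w z ≠ 0 → z ∈ Z)
    (q : ζ → τ → ℝ) (hq : ∀ z t, 0 ≤ q z t)
    (p : ζ → τ → BitString n → ℝ) (hp : ∀ z t x, 0 ≤ p z t x) (hp1 : ∀ z t, ∑ x, p z t x = 1)
    {s : ℝ} (hs0 : 0 < s) (hs1 : s ≤ 1) {m : ℕ} (hm : 0 < m)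
    (hq1 : ∀ z, ∑ t, q z t = 1)
    (hcard : (Z.card : ℝ) ≤ Real.exp (s ^ 2 * m)) :
    ∃ h : (Fin m → BitString n) → ℝ, (∀ c, |h c| ≤ 1) ∧
      ∑ c, ((1 / 2 : ℝ) ^ n) ^ m * h c ≤ 2 * s ∧
      ∑ z, w z * uniformExcess (fun x => ∑ t, q z t * p z t x) ≤
        ∑ z, w z * ∑ t, q z t * ∑ c : Fin m → BitString n, (∏ i, p z t (c i)) * h c := by
  classical
  set u : ℝ := (1 / 2) ^ n with hu
  have hu0 : 0 ≤ u := by positivity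
  have hu1 : ∑ _y : BitString n, u = 1 := by simp [hu]
  let P : ζ → BitString n → ℝ := fun z x => ∑ t, q z t * p z t x
  have hP1 : ∀ z, ∑ x, P z x = 1 := fun z => by
    simp only [P]
    rw [Finset.sum_comm]
    simp only [← Finset.mul_sum, hp1, mul_one, hq1]
  -- The event on which the codeword law given `z` exceeds uniform; its bias equals the total
  -- variation distance.
  let e : ζ → BitString n → ℝ := fun z x => if u < P z x then 1 else 0
  let a : ζ → ℝ := fun z => ∑ x, u * e z x
  have he0 : ∀ z x, 0 ≤ e z x := fun z x => by simp only [e]; split_ifs <;> norm_num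
  have he1 : ∀ z x, e z x ≤ 1 := fun z x => by simp only [e]; split_ifs <;> norm_num
  have ha0 : ∀ z, 0 ≤ a z := fun z => Finset.sum_nonneg fun x _ => mul_nonneg hu0 (he0 z x)
  have ha1 : ∀ z, a z ≤ 1 := fun z => by
    rw [← hu1]
    exact Finset.sum_le_sum fun x _ => mul_le_of_le_one_right hu0 (he1 z x)
  obtain ⟨h, hh1, hhZ, hhu⟩ := exists_max_average Z hZ hu0 hu1 (fun z x => e z x - a z)
    (fun z x => abs_le.2 ⟨by linarith [he0 z x, ha1 z], by linarith [he1 z x, ha0 z]⟩)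
    (fun z => by
      simp only [mul_sub, Finset.sum_sub_distrib, ← Finset.sum_mul, hu1]
      simp [a]) hs0 hs1 hm hcard
  refine ⟨h, hh1, hhu, Finset.sum_le_sum fun z _ => ?_⟩
  by_cases hz : w z = 0
  · simp [hz]
  refine mul_le_mul_of_nonneg_left ?_ (hw z)
  have h1 : uniformExcess (P z) = ∑ x, P z x * (e z x - a z) := by
    simp only [mul_sub, Finset.sum_sub_distrib, ← Finset.sum_mul, hP1, one_mul, a]
    rw [← Finset.sum_sub_distrib]
    refine Finset.sum_congr rfl fun x _ => ?_
    simp only [e]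
    split_ifs with hx
    · rw [max_eq_left (by linarith)]
      ring
    · rw [max_eq_right (by linarith)]
      ring
  have h2 : ∑ x, P z x * (e z x - a z) = ∑ t, q z t * ∑ x, p z t x * (e z x - a z) := by
    simp only [P, Finset.sum_mul, Finset.mul_sum]
    rw [Finset.sum_comm]
    simp only [mul_assoc]
  change uniformExcess (P z) ≤ _
  rw [h1, h2]
  refine Finset.sum_le_sum fun t _ => mul_le_mul_of_nonneg_left ?_ (hq z t)
  -- Given `z` alone the samples are not independent, but they are given `z` and `t`. As an
  -- empirical average is linear, averaging its mean over `t` gives the bias of the law of one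
  -- codeword given `z`.
  rw [← sum_pi_mul_average (hp1 z t) hm]
  exact Finset.sum_le_sum fun c _ => mul_le_mul_of_nonneg_left (hhZ z (hwZ z hz) c)
    (Finset.prod_nonneg fun i _ => hp z t (c i))

/-! ### The bound for one value of the security parameter -/

namespace ZeroBitCode

variable (P : ZeroBitCode) (κ : ℕ)

/-- The weight of the key `sk` together with the queries and answers of the key generation. -/
def keyWeight (sk : BitString (P.keyLen κ)) (K : PartialOracle (BitString κ)) : ℝ :=
  leafWeight (P.keyGen κ) sk K * (1 / 2) ^ K.size

theorem keyWeight_nonneg (sk : BitString (P.keyLen κ)) (K : PartialOracle (BitString κ)) :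
    0 ≤ P.keyWeight κ sk K :=
  mul_nonneg ENNReal.toReal_nonneg (by positivity)

/-- Conditioned on the key and on the trace `K` of the key generation, the oracle is uniform among
the extensions of `K`. The factor `(1/2) ^ K.size` in `keyWeight` is the probability that a random
oracle extends `K`. -/
theorem toReal_setup (R : Oracle κ) (sk : BitString (P.keyLen κ)) :
    (P.setup κ (R, sk)).toReal = ∑ K, P.keyWeight κ sk K * oracleProb K R := by
  classical
  have h1 : (P.setup κ (R, sk)).toReal =
      (1 / 2) ^ Fintype.card (BitString κ) * ((P.keyGen κ).run R sk).toReal := by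
    rw [setup, PMF.toReal_bind_apply, Finset.sum_eq_single R]
    · congr 1
      · simp
      · congr 1
        rw [PMF.map_apply, tsum_eq_single sk]
        · simp
        · intro sk' h
          simp [h.symm]
    · intro R' _ h
      rw [PMF.map_apply]
      simp [h.symm]
    · simp
  rw [h1, toReal_run_eq_sum, Finset.mul_sum]
  refine Finset.sum_congr rfl fun K _ => ?_
  rw [mul_left_comm, oracleProb_mul_pow_size, keyWeight]
  ring

theorem sum_keyWeight : ∑ sk, ∑ K, P.keyWeight κ sk K = 1 := by
  have h := PMF.sum_toReal (P.setup κ)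
  rw [Fintype.sum_prod_type] at h
  simp only [toReal_setup] at h
  rw [← h, Finset.sum_comm (γ := Oracle κ)]
  refine Finset.sum_congr rfl fun sk _ => ?_
  rw [Finset.sum_comm]
  simp only [← Finset.mul_sum, sum_oracleProb, mul_one]

variable {P κ}

section Mixture

/-- The joint law of oracle and key is that of an oracle extending a partial oracle `K`, for a pair
of a key and a partial oracle of law `w`. -/
def IsSetupLaw (P : ZeroBitCode) (κ : ℕ)
    (w : BitString (P.keyLen κ) → PartialOracle (BitString κ) → ℝ) : Prop :=
  ∀ sk R, ∑ K, w sk K * oracleProb K R = ∑ K, P.keyWeight κ sk K * oracleProb K R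

variable {w : BitString (P.keyLen κ) → PartialOracle (BitString κ) → ℝ}

theorem sum_setup_mul (hlaw : P.IsSetupLaw κ w)
    (F : Oracle κ → BitString (P.keyLen κ) → ℝ) :
    ∑ s : Oracle κ × BitString (P.keyLen κ), (P.setup κ s).toReal * F s.1 s.2 =
      ∑ sk, ∑ K, w sk K * ∑ R, oracleProb K R * F R sk := by
  rw [Fintype.sum_prod_type, Finset.sum_comm]
  refine Finset.sum_congr rfl fun sk _ => ?_
  simp only [toReal_setup, ← hlaw _ _, Finset.sum_mul, Finset.mul_sum]
  rw [Finset.sum_comm]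
  simp only [mul_assoc]

theorem toReal_completenessExp (hlaw : P.IsSetupLaw κ w) (ρ : unitInterval) :
    (P.completenessExp κ ρ true).toReal = ∑ sk, ∑ K, w sk K *
      commonAccept (leafWeight (P.enc κ sk)) (fun y => leafWeight (P.dec κ sk y)) ρ K := by
  rw [completenessExp, PMF.toReal_bind_apply]
  simp only [PMF.toReal_bind_apply, toReal_run_eq_sum, toReal_noise]
  exact sum_setup_mul hlaw fun R sk => ∑ c, (∑ S, leafWeight (P.enc κ sk) c S * oracleMatch S R) *
    ∑ y, noiseKernel ρ c y * ∑ T, leafWeight (P.dec κ sk y) true T * oracleMatch T R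

theorem toReal_soundnessExp (hlaw : P.IsSetupLaw κ w) (y : BitString (P.blockLen κ)) :
    (P.soundnessExp κ y true).toReal =
      ∑ sk, ∑ K, w sk K * outProb (leafWeight (P.dec κ sk y)) K true := by
  rw [soundnessExp, PMF.toReal_bind_apply]
  simp only [toReal_run_eq_sum]
  refine (sum_setup_mul hlaw fun R sk =>
    ∑ T, leafWeight (P.dec κ sk y) true T * oracleMatch T R).trans ?_
  refine Finset.sum_congr rfl fun sk _ => Finset.sum_congr rfl fun K _ => ?_
  simp only [outProb, matchProb, Finset.mul_sum]
  rw [Finset.sum_comm]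
  refine Finset.sum_congr rfl fun S _ => Finset.sum_congr rfl fun R _ => ?_
  ring

theorem toReal_realExp (hlaw : P.IsSetupLaw κ w) {m : ℕ}
    (A : (Fin m → BitString (P.blockLen κ)) → PMF Bool) :
    (P.realExp κ m A true).toReal = ∑ sk, ∑ K, w sk K * ∑ R, oracleProb K R *
      ∑ c : Fin m → BitString (P.blockLen κ),
        (∏ i, ((P.enc κ sk).run R (c i)).toReal) * (A c true).toReal := by
  rw [realExp, PMF.toReal_bind_apply]
  simp only [PMF.toReal_bind_apply, toReal_iidSamples]
  exact sum_setup_mul hlaw fun R sk => ∑ c : Fin m → BitString (P.blockLen κ),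
    (∏ i, ((P.enc κ sk).run R (c i)).toReal) * (A c true).toReal

end Mixture

theorem toReal_idealExp {m : ℕ} (A : (Fin m → BitString (P.blockLen κ)) → PMF Bool) :
    (P.idealExp κ m A true).toReal = ∑ c : Fin m → BitString (P.blockLen κ),
      ((1 / 2 : ℝ) ^ P.blockLen κ) ^ m * (A c true).toReal := by
  rw [idealExp, PMF.toReal_bind_apply]
  simp [toReal_iidSamples]

/-- The adversary that outputs `1` with probability `(1 + h) / 2`. -/
theorem exists_adversary {Y : Type} (h : Y → ℝ) (hh : ∀ y, |h y| ≤ 1) :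
    ∃ A : Y → PMF Bool, ∀ y, (A y true).toReal = (1 + h y) / 2 := by
  have h0 : ∀ y, 0 ≤ (1 + h y) / 2 := fun y => by linarith [(abs_le.1 (hh y)).1]
  have h1 : ∀ y, Real.toNNReal ((1 + h y) / 2) ≤ 1 := fun y => by
    rw [Real.toNNReal_le_one]
    linarith [(abs_le.1 (hh y)).2]
  refine ⟨fun y => PMF.ofFintype (fun b => if b then (Real.toNNReal ((1 + h y) / 2) : ENNReal) else
    1 - (Real.toNNReal ((1 + h y) / 2) : ENNReal)) ?_, fun y => ?_⟩
  · have : (Real.toNNReal ((1 + h y) / 2) : ENNReal) ≤ 1 := by exact_mod_cast h1 y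
    simp [add_tsub_cancel_of_le this]
  · simp [h0 y]

theorem uniformExcess_eq_zero {p : BitString 0 → ℝ} (hp : ∑ x, p x = 1) : uniformExcess p = 0 := by
  rw [Fintype.sum_unique] at hp
  simp [uniformExcess, hp]

/-- The adversary is fixed before `δ`, `ε`, `μ`, as pseudorandomness is invoked for a whole family
of adversaries. Of the two final bounds, the first adds the collision probability and the second
pays the factor `2 ^ Q` instead. `T` is the average distance of one codeword from uniform given the
key and the learned answers. -/
theorem exists_adversary_bound {ρ : unitInterval} {Q D : ℕ}
    (hkey : (P.keyGen κ).QueriesAtMost Q)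
    (henc : ∀ sk, (P.enc κ sk).QueriesAtMost Q)
    (hdec : ∀ sk x, (P.dec κ sk x).QueriesAtMost Q) (hD : 0 < D)
    {s : ℝ} (hs0 : 0 < s) (hs1 : s ≤ 1) {m : ℕ} (hm : 0 < m)
    (hcard : (2 : ℝ) ^ P.keyLen κ * ((2 ^ κ : ℝ) ^ (Q + D) * Real.exp 2) ≤ Real.exp (s ^ 2 * m)) :
    ∃ A : (Fin m → BitString (P.blockLen κ)) → PMF Bool, ∀ δ ε μ : ℝ,
      |(P.realExp κ m A true).toReal - (P.idealExp κ m A true).toReal| ≤ ε →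
      1 - δ ≤ (P.completenessExp κ ρ true).toReal →
      (∀ x, 1 - μ ≤ (P.soundnessExp κ x false).toReal) →
      ∃ T : ℝ, 0 ≤ T ∧ T ≤ 2 * ε + 2 * s ∧ (P.blockLen κ = 0 → T = 0) ∧
        1 - δ - μ ≤ 2 * T + Q * (Q / D : ℝ) ^ ((1 - (ρ : ℝ)) / 4) ∧
        1 - δ ≤ 2 ^ Q * (μ + T) := by
  classical
  have h0 : (0 : ℝ) ≤ ρ := ρ.2.1
  have h1 : (ρ : ℝ) ≤ 1 := ρ.2.2
  have hWe : ∀ sk, IsLeafWeight (leafWeight (P.enc κ sk)) Q := fun sk =>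
    isLeafWeight_leafWeight _ (henc sk)
  have hWd : ∀ sk y, IsLeafWeight (leafWeight (P.dec κ sk y)) Q := fun sk y =>
    isLeafWeight_leafWeight _ (hdec sk y)
  obtain ⟨w, hw0, (hlaw : P.IsSetupLaw κ w), hsize, hheavy⟩ := exists_light_extension
    (fun sk => leafWeight (P.enc κ sk)) hWe (P.keyWeight κ) (P.keyWeight_nonneg κ)
    (P.sum_keyWeight κ) (Q₀ := Q) (fun sk K h =>
      (isLeafWeight_leafWeight _ hkey).size_le sk K (left_ne_zero_of_mul h)) hD
  have hw1 : ∑ sk, ∑ K, w sk K = 1 := by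
    rw [← P.sum_keyWeight κ]
    refine Finset.sum_congr rfl fun sk _ => ?_
    have := Finset.sum_congr rfl fun R (_ : R ∈ Finset.univ) => hlaw sk R
    rw [Finset.sum_comm, Finset.sum_comm (γ := Oracle κ)] at this
    simpa only [← Finset.mul_sum, sum_oracleProb, mul_one] using this
  let Z : Finset (BitString (P.keyLen κ) × PartialOracle (BitString κ)) :=
    Finset.univ ×ˢ Finset.univ.filter fun K : PartialOracle (BitString κ) => K.size ≤ Q + D
  have hZ : Z.Nonempty := ⟨(default, fun _ => none), by simp [Z, PartialOracle.size]⟩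
  have hZc : (Z.card : ℝ) ≤ Real.exp (s ^ 2 * m) := by
    refine le_trans ?_ hcard
    have := card_size_le (X := BitString κ) (Q + D)
    simp only [Z, Finset.card_product, Finset.card_univ, Fintype.card_pi, Fintype.card_bool,
      Finset.prod_const, Fintype.card_fin, Nat.cast_mul, Nat.cast_pow, Nat.cast_ofNat] at this ⊢
    exact mul_le_mul_of_nonneg_left this (by positivity)
  obtain ⟨h, hh1, hhu, hhw⟩ := exists_statistic Z hZ (fun z => w z.1 z.2) (fun z => hw0 _ _)
    (fun z hz => by simpa [Z] using hsize _ _ hz) (fun z R => oracleProb z.2 R)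
    (fun z R => oracleProb_nonneg _ _)
    (fun z R x => ((P.enc κ z.1).run R x).toReal) (fun z R x => ENNReal.toReal_nonneg)
    (fun z R => PMF.sum_toReal _) hs0 hs1 hm (fun z => sum_oracleProb _) hZc
  obtain ⟨A, hA⟩ := exists_adversary h hh1
  refine ⟨A, fun δ ε μ hε hδ hμ => ?_⟩
  have hout : ∀ sk K, (fun x => ∑ R, oracleProb K R * ((P.enc κ sk).run R x).toReal) =
      outProb (leafWeight (P.enc κ sk)) K := by
    intro sk K
    ext x
    simp only [toReal_run_eq_sum, outProb, matchProb, Finset.mul_sum]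
    rw [Finset.sum_comm]
    refine Finset.sum_congr rfl fun S _ => Finset.sum_congr rfl fun R _ => ?_
    ring
  rw [Fintype.sum_prod_type, Fintype.sum_prod_type] at hhw
  simp only [hout] at hhw
  set T : ℝ := ∑ sk, ∑ K, w sk K * uniformExcess (outProb (leafWeight (P.enc κ sk)) K) with hT
  have hT0 : 0 ≤ T := Finset.sum_nonneg fun sk _ => Finset.sum_nonneg fun K _ =>
    mul_nonneg (hw0 sk K) (uniformExcess_nonneg _)
  have hreal : (P.realExp κ m A true).toReal = (1 + ∑ sk, ∑ K, w sk K * ∑ R, oracleProb K R *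
      ∑ c : Fin m → BitString (P.blockLen κ),
        (∏ i, ((P.enc κ sk).run R (c i)).toReal) * h c) / 2 := by
    have hc : ∀ sk R, ∑ c : Fin m → BitString (P.blockLen κ),
        (∏ i, ((P.enc κ sk).run R (c i)).toReal) = 1 := fun sk R => by
      rw [sum_prod_eq_prod_sum fun _ x => ((P.enc κ sk).run R x).toReal]
      simp [PMF.sum_toReal]
    rw [toReal_realExp hlaw]
    simp only [hA, mul_div_assoc', mul_add, mul_one, ← Finset.sum_div, Finset.sum_add_distrib, hc,
      sum_oracleProb, hw1]
  have hideal : (P.idealExp κ m A true).toReal = (1 + ∑ c : Fin m → BitString (P.blockLen κ),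
      ((1 / 2 : ℝ) ^ P.blockLen κ) ^ m * h c) / 2 := by
    rw [toReal_idealExp]
    simp only [hA, mul_div_assoc', mul_add, mul_one, ← Finset.sum_div, Finset.sum_add_distrib]
    congr 2
    exact sum_pi_const _ (by simp) m
  have hTε : T ≤ 2 * ε + 2 * s := by
    rw [hreal, hideal] at hε
    have := (abs_le.1 hε).2
    linarith
  have hμ' : ∑ sk, ∑ K, w sk K * ∑ y, (1 / 2) ^ P.blockLen κ *
      outProb (leafWeight (P.dec κ sk y)) K true ≤ μ := by
    have e : ∑ sk, ∑ K, w sk K * ∑ y, (1 / 2) ^ P.blockLen κ *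
        outProb (leafWeight (P.dec κ sk y)) K true =
        ∑ y, (1 / 2) ^ P.blockLen κ * (P.soundnessExp κ y true).toReal := by
      simp only [toReal_soundnessExp hlaw, Finset.mul_sum]
      rw [Finset.sum_comm (γ := BitString (P.blockLen κ))]
      refine Finset.sum_congr rfl fun sk _ => ?_
      rw [Finset.sum_comm]
      refine Finset.sum_congr rfl fun y _ => Finset.sum_congr rfl fun K _ => ?_
      ring
    have hs : ∀ y, (P.soundnessExp κ y true).toReal ≤ μ := fun y => by
      have := PMF.sum_toReal (P.soundnessExp κ y)
      rw [Fintype.sum_bool] at this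
      linarith [hμ y]
    rw [e]
    refine (Finset.sum_le_sum fun y _ => mul_le_mul_of_nonneg_left (hs y) (by positivity)).trans ?_
    simp
  have hsep : ∑ sk, ∑ K, w sk K *
      separateAccept (leafWeight (P.enc κ sk)) (fun y => leafWeight (P.dec κ sk y)) ρ K ≤ T + μ := by
    refine le_trans ?_ (add_le_add le_rfl hμ')
    simp only [hT, ← Finset.sum_add_distrib, ← mul_add]
    exact Finset.sum_le_sum fun sk _ => Finset.sum_le_sum fun K _ =>
      mul_le_mul_of_nonneg_left (separateAccept_le K h0 h1 (hWd sk)) (hw0 sk K)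
  rw [toReal_completenessExp hlaw] at hδ
  refine ⟨T, hT0, hTε, fun hn => ?_, ?_, ?_⟩
  · refine Finset.sum_eq_zero fun sk _ => Finset.sum_eq_zero fun K _ => ?_
    have hs := (hWe sk).sum_outProb K
    revert hs
    generalize outProb (leafWeight (P.enc κ sk)) K = p
    intro hs
    have : ∀ n : ℕ, n = 0 → ∀ p : BitString n → ℝ, ∑ x, p x = 1 → uniformExcess p = 0 := by
      rintro _ rfl p hp
      exact uniformExcess_eq_zero hp
    rw [this _ hn p hs, mul_zero]
  -- Only the average of the heaviest query probability is controlled; concavity of `x ^ ((1-ρ)/4)`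
  -- passes this to the power.
  · have hjensen : ∑ sk, ∑ K, w sk K * heaviest (leafWeight (P.enc κ sk)) K ^ ((1 - (ρ : ℝ)) / 4) ≤
        (Q / D : ℝ) ^ ((1 - (ρ : ℝ)) / 4) := by
      have hc := (Real.concaveOn_rpow (p := (1 - (ρ : ℝ)) / 4) (by linarith) (by linarith)).le_map_sum
        (t := Finset.univ)
        (w := fun z : BitString (P.keyLen κ) × PartialOracle (BitString κ) => w z.1 z.2)
        (p := fun z => heaviest (leafWeight (P.enc κ z.1)) z.2) (fun z _ => hw0 _ _)
        (by rw [Fintype.sum_prod_type]; exact hw1) (fun z _ => heaviest_nonneg (hWe z.1) z.2)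
      simp only [smul_eq_mul] at hc
      rw [Fintype.sum_prod_type, Fintype.sum_prod_type] at hc
      refine hc.trans (Real.rpow_le_rpow (Finset.sum_nonneg fun sk _ => Finset.sum_nonneg fun K _ =>
        mul_nonneg (hw0 sk K) (heaviest_nonneg (hWe sk) K)) hheavy (by linarith))
    have hcoll : ∑ sk, ∑ K, w sk K *
        collisionProb (leafWeight (P.enc κ sk)) (fun y => leafWeight (P.dec κ sk y)) ρ K ≤
        T + Q * (Q / D : ℝ) ^ ((1 - (ρ : ℝ)) / 4) := by
      refine le_trans ?_ (add_le_add le_rfl (mul_le_mul_of_nonneg_left hjensen Q.cast_nonneg))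
      simp only [hT, Finset.mul_sum, ← Finset.sum_add_distrib]
      refine Finset.sum_le_sum fun sk _ => Finset.sum_le_sum fun K _ => ?_
      have := mul_le_mul_of_nonneg_left (collisionProb_le K h0 h1 (hWe sk) (hWd sk)
        (heaviest_nonneg (hWe sk) K) (queryProb_le_heaviest _ K)) (hw0 sk K)
      linarith
    have hcommon : ∑ sk, ∑ K, w sk K *
        commonAccept (leafWeight (P.enc κ sk)) (fun y => leafWeight (P.dec κ sk y)) ρ K ≤
        ∑ sk, ∑ K, w sk K *
          separateAccept (leafWeight (P.enc κ sk)) (fun y => leafWeight (P.dec κ sk y)) ρ K +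
        ∑ sk, ∑ K, w sk K *
          collisionProb (leafWeight (P.enc κ sk)) (fun y => leafWeight (P.dec κ sk y)) ρ K := by
      simp only [← Finset.sum_add_distrib, ← mul_add]
      exact Finset.sum_le_sum fun sk _ => Finset.sum_le_sum fun K _ =>
        mul_le_mul_of_nonneg_left (commonAccept_le_add K h0 h1 (hWe sk) (hWd sk)) (hw0 sk K)
    linarith
  · have hcommon : ∑ sk, ∑ K, w sk K *
        commonAccept (leafWeight (P.enc κ sk)) (fun y => leafWeight (P.dec κ sk y)) ρ K ≤
        2 ^ Q * ∑ sk, ∑ K, w sk K *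
          separateAccept (leafWeight (P.enc κ sk)) (fun y => leafWeight (P.dec κ sk y)) ρ K := by
      simp only [Finset.mul_sum]
      refine Finset.sum_le_sum fun sk _ => Finset.sum_le_sum fun K _ => ?_
      rw [mul_left_comm]
      exact mul_le_mul_of_nonneg_left (commonAccept_le_mul K h0 h1 (hWe sk) (hWd sk)) (hw0 sk K)
    refine hδ.trans (hcommon.trans ?_)
    rw [add_comm μ]
    exact mul_le_mul_of_nonneg_left hsep (by positivity)

end ZeroBitCode

/-! ### Asymptotics -/

/-- The lower bound on `d = δ + μ` with exponent `e`. -/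
def GapBound (κ Q n : ℕ) (ε d e : ℝ) : Prop :=
  d ≥ 1 - (Q : ℝ) ^ 2 * (κ : ℝ) ^ (-e) - 4 * ((Q : ℝ) ^ 2 * Real.sqrt (ε * (n : ℝ)))

theorem gapBound_of_one_le {κ Q n : ℕ} {ε d e : ℝ} (hd : 0 ≤ d)
    (h : 1 ≤ (Q : ℝ) ^ 2 * (κ : ℝ) ^ (-e)) : GapBound κ Q n ε d e := by
  have : 0 ≤ 4 * ((Q : ℝ) ^ 2 * Real.sqrt (ε * (n : ℝ))) := by positivity
  unfold GapBound
  linarith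

/-- The argument yields an error linear in `ε`. It is below `√(ε n)` if `n ≥ 1` and `ε ≤ 1`; for `n
= 0` there is no distance at all, and for `ε ≥ 1` the bound to be proved is trivial. -/
theorem le_sqrt_mul_or {n : ℕ} {ε s T : ℝ} (hε : 0 ≤ ε) (hs : 0 ≤ s) (hT : T ≤ 2 * ε + 2 * s)
    (hn : n = 0 → T = 0) : T ≤ 2 * √(ε * n) + 2 * s ∨ 1 ≤ √(ε * n) := by
  rcases Nat.eq_zero_or_pos n with h | h
  · left
    rw [hn h]
    positivity
  have hn1 : (1 : ℝ) ≤ n := by exact_mod_cast h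
  rcases le_total ε 1 with h1 | h1
  · left
    have : ε ≤ √(ε * n) := by
      apply Real.le_sqrt_of_sq_le
      nlinarith
    linarith
  · right
    rw [Real.one_le_sqrt]
    nlinarith

/-! ### Choice of parameters and the diagonal argument. -/

/-- The choice of parameters for one exponent. -/
theorem exists_gapBound {κ Q n : ℕ} {k : ℕ} {θ ε δ μ T : ℝ} (hκ : 16 ≤ κ) (hQ : 1 ≤ Q)
    (hθ0 : 0 ≤ θ) (hθ1 : θ ≤ 1) (hε : 0 ≤ ε) (hδ : 0 ≤ δ)
    (hy : (Q : ℝ) ^ 2 * (κ : ℝ) ^ (-(k * θ)) < 1) (hQk : (Q : ℝ) ≤ (κ : ℝ) ^ k)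
    (hT : T ≤ 2 * ε + 2 * ((κ : ℝ) ^ (k + 1))⁻¹) (hn : n = 0 → T = 0)
    (h1 : 1 - δ - μ ≤ 2 * T + Q * (Q / (κ ^ (17 * k) : ℕ) : ℝ) ^ (θ / 4))
    (h2 : 1 - δ ≤ 2 ^ Q * (μ + T)) (hμ : 0 ≤ μ) :
    ∃ e, k * θ ≤ e ∧ GapBound κ Q n ε (δ + μ) e := by
  have hκ' : (16 : ℝ) ≤ κ := by exact_mod_cast hκ
  have hκ0 : (0 : ℝ) < κ := by linarith
  have hQ' : (1 : ℝ) ≤ Q := by exact_mod_cast hQ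
  have hQ2 : (1 : ℝ) ≤ (Q : ℝ) ^ 2 := one_le_pow₀ hQ'
  set s : ℝ := ((κ : ℝ) ^ (k + 1))⁻¹ with hs
  set y : ℝ := (κ : ℝ) ^ (-(k * θ)) with hydef
  have hy0 : 0 < y := Real.rpow_pos_of_pos hκ0 _
  have hpk : (1 : ℝ) ≤ (κ : ℝ) ^ k := one_le_pow₀ (by linarith)
  have hs0 : 0 ≤ s := by positivity
  have hsy : 16 * s ≤ y := by
    have e1 : ((κ : ℝ) ^ k)⁻¹ ≤ y := by
      rw [hydef, ← Real.rpow_natCast, ← Real.rpow_neg hκ0.le]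
      exact Real.rpow_le_rpow_of_exponent_le (by linarith)
        (neg_le_neg (mul_le_of_le_one_right (Nat.cast_nonneg k) hθ1))
    refine le_trans ?_ e1
    rw [hs, pow_succ, mul_inv]
    have : (κ : ℝ)⁻¹ ≤ 1 / 16 := by
      rw [inv_eq_one_div]
      exact one_div_le_one_div_of_le (by norm_num) hκ'
    nlinarith [inv_nonneg.2 (zero_le_one.trans hpk)]
  rcases le_sqrt_mul_or hε hs0 hT hn with hT' | hbig
  swap
  · refine ⟨k * θ, le_rfl, ?_⟩
    have : 0 ≤ (Q : ℝ) ^ 2 * y := by positivity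
    unfold GapBound
    nlinarith
  set r : ℝ := √(ε * n) with hr
  have hr0 : 0 ≤ r := Real.sqrt_nonneg _
  -- For `y` close to `1` the gap between `y` and `y ^ 4` may be too small to absorb the error `4 *
  -- s`. There `Q ^ 2 * y < 1` forces `Q = 1`, and `1 - δ ≤ 2 * (μ + T)` already gives the bound
  -- with `y` replaced by `3 / 4`; the exponent `log (4/3) / log κ` realises this value and is at
  -- least `k * θ`.
  rcases le_or_gt (3 / 4) y with hy34 | hy34
  · have hQ1 : Q = 1 := by
      by_contra hne
      have : (2 : ℝ) ≤ Q := by exact_mod_cast (by omega : 2 ≤ Q)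
      nlinarith
    have hy1 : y < 1 := by nlinarith
    have hlog : 0 < Real.log κ := Real.log_pos (by linarith)
    have hke : (κ : ℝ) ^ (-(Real.log (4 / 3) / Real.log κ)) = 3 / 4 := by
      rw [Real.rpow_def_of_pos hκ0, mul_neg, mul_div_cancel₀ _ hlog.ne', ← Real.log_inv,
        Real.exp_log (by norm_num)]
      norm_num
    refine ⟨Real.log (4 / 3) / Real.log κ, ?_, ?_⟩
    · rw [← hke, hydef] at hy34
      have := (Real.rpow_le_rpow_left_iff (by linarith : (1 : ℝ) < κ)).1 hy34
      linarith
    · unfold GapBound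
      rw [hke, ← hr]
      subst hQ1
      norm_num at h2 ⊢
      linarith
  · refine ⟨k * θ, le_rfl, ?_⟩
    -- With `D = κ ^ (17 * k)` and `Q ≤ κ ^ k` the ratio is at most `κ ^ (-16k)`, whose power `θ /
    -- 4` is `y ^ 4`. For `y < 3/4` this is below `y / 2`, which leaves room for `4 * s ≤ y / 4`.
    have hpow : (Q / (κ ^ (17 * k) : ℕ) : ℝ) ^ (θ / 4) ≤ y ^ 4 := by
      have e1 : (Q / (κ ^ (17 * k) : ℕ) : ℝ) ≤ (κ : ℝ) ^ (-(16 * k : ℝ)) := by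
        rw [Nat.cast_pow, div_le_iff₀ (by positivity), Real.rpow_neg hκ0.le]
        have : (κ : ℝ) ^ (16 * k : ℝ) = (κ : ℝ) ^ (16 * k) := by
          rw [← Real.rpow_natCast]
          push_cast
          rfl
        rw [this, show 17 * k = 16 * k + k by ring, pow_add, inv_mul_cancel_left₀ (by positivity)]
        exact hQk
      refine (Real.rpow_le_rpow (by positivity) e1 (by linarith)).trans (le_of_eq ?_)
      rw [← Real.rpow_mul hκ0.le, hydef, ← Real.rpow_natCast (_ ^ _) 4, ← Real.rpow_mul hκ0.le]
      congr 1
      push_cast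
      ring
    have hy4 : y ^ 4 ≤ y / 2 := by
      have : y ^ 3 ≤ (3 / 4) ^ 3 := pow_le_pow_left₀ hy0.le hy34.le 3
      nlinarith
    have h3 : (Q : ℝ) * (Q / (κ ^ (17 * k) : ℕ) : ℝ) ^ (θ / 4) ≤ Q ^ 2 * (y / 2) := by
      have := mul_le_mul_of_nonneg_left (hpow.trans hy4) (zero_le_one.trans hQ')
      have h5 : (Q : ℝ) * (y / 2) ≤ Q ^ 2 * (y / 2) :=
        mul_le_mul_of_nonneg_right (by nlinarith) (by linarith)
      linarith
    unfold GapBound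
    rw [← hr]
    nlinarith [mul_le_mul_of_nonneg_right hQ2 hy0.le, mul_le_mul_of_nonneg_right hQ2 hr0]

/-- Exponents at least `k * θ` for each `k` and all large `κ` combine to an exponent of larger order
than `θ`. -/
theorem exists_exponent_of_forall {θ : ℕ → ℝ} (hθ : ∀ κ, 0 ≤ θ κ) {B : ℕ → ℝ → Prop}
    (h0 : ∀ κ, B κ 0) (h : ∀ k : ℕ, ∀ᶠ κ in atTop, ∃ e, k * θ κ ≤ e ∧ B κ e) :
    ∃ η : ℕ → ℝ, (∀ κ, 0 ≤ η κ) ∧ θ =o[atTop] η ∧ ∀ κ, B κ (η κ) := by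
  classical
  let p : ℕ → ℕ → Prop := fun κ k => ∃ e, k * θ κ ≤ e ∧ B κ e
  have hp0 : ∀ κ, p κ 0 := fun κ => ⟨0, by simp, h0 κ⟩
  -- Diagonal choice: the largest admissible `k ≤ κ`. It exists because `k = 0` is always
  -- admissible, and it tends to infinity because each fixed `k` is eventually admissible.
  let g : ℕ → ℕ := fun κ => Nat.findGreatest (p κ) κ
  have hg : ∀ κ, p κ (g κ) := fun κ => Nat.findGreatest_spec (Nat.zero_le κ) (hp0 κ)
  choose η hη using hg
  have hη0 : ∀ κ, 0 ≤ η κ := fun κ => (mul_nonneg (Nat.cast_nonneg _) (hθ κ)).trans (hη κ).1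
  refine ⟨η, hη0, ?_, fun κ => (hη κ).2⟩
  rw [isLittleO_iff]
  intro c hc
  obtain ⟨k, hk⟩ := exists_nat_gt (1 / c)
  filter_upwards [h k, eventually_ge_atTop k] with κ hκ hkκ
  have hgk : k ≤ g κ := Nat.le_findGreatest hkκ hκ
  rw [Real.norm_of_nonneg (hθ κ), Real.norm_of_nonneg (hη0 κ)]
  have h1 : (k : ℝ) * θ κ ≤ η κ :=
    (mul_le_mul_of_nonneg_right (by exact_mod_cast hgk) (hθ κ)).trans (hη κ).1
  rw [div_lt_iff₀ hc] at hk
  nlinarith [hθ κ, mul_le_mul_of_nonneg_left h1 hc.le]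

namespace ZeroBitCode

/-- The number of samples is `s⁻²`, with `s = κ ^ (-(k+1))`, times a polynomial bound for the
logarithm of the number of pairs of a key and a partial oracle. The base `2` is replaced by `e`. -/
theorem card_bound {κ Q ℓ p k : ℕ} (hκ : 1 ≤ κ) (hp : ℓ ≤ p) (hQ : Q ≤ κ ^ k) :
    (2 : ℝ) ^ ℓ * ((2 ^ κ : ℝ) ^ (Q + κ ^ (17 * k)) * Real.exp 2) ≤
      Real.exp ((((κ : ℝ) ^ (k + 1))⁻¹) ^ 2 *
        ((κ ^ (2 * (k + 1)) * (p + κ * (κ ^ k + κ ^ (17 * k)) + 2) : ℕ) : ℝ)) := by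
  have hκ0 : (κ : ℝ) ≠ 0 := by exact_mod_cast (by omega : κ ≠ 0)
  have h2 : (2 : ℝ) ≤ Real.exp 1 := by linarith [Real.add_one_le_exp (1 : ℝ)]
  calc (2 : ℝ) ^ ℓ * ((2 ^ κ : ℝ) ^ (Q + κ ^ (17 * k)) * Real.exp 2)
      ≤ Real.exp 1 ^ ℓ * ((Real.exp 1 ^ κ) ^ (Q + κ ^ (17 * k)) * Real.exp 2) := by gcongr
    _ = Real.exp ((ℓ + κ * (Q + κ ^ (17 * k)) + 2 : ℕ) : ℝ) := by
        simp only [← Real.exp_nat_mul, ← Real.exp_add]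
        congr 1
        push_cast
        ring
    _ ≤ _ := by
        apply Real.exp_le_exp.2
        have e : (((κ : ℝ) ^ (k + 1))⁻¹) ^ 2 *
            ((κ ^ (2 * (k + 1)) * (p + κ * (κ ^ k + κ ^ (17 * k)) + 2) : ℕ) : ℝ) =
            ((p + κ * (κ ^ k + κ ^ (17 * k)) + 2 : ℕ) : ℝ) := by
          rw [Nat.cast_mul, ← mul_assoc, Nat.cast_pow, inv_pow, ← pow_mul, mul_comm (k + 1) 2,
            inv_mul_cancel₀ (pow_ne_zero _ hκ0), one_mul]
        rw [e]
        have : ℓ + κ * (Q + κ ^ (17 * k)) + 2 ≤ p + κ * (κ ^ k + κ ^ (17 * k)) + 2 := by gcongr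
        exact_mod_cast this

variable {P : ZeroBitCode} {ρ : ℕ → unitInterval} {δ ε μ : ℕ → ℝ} {Q : ℕ → ℕ}

theorem toReal_apply_le_one {α : Type} (p : PMF α) (a : α) : (p a).toReal ≤ 1 := by
  have := ENNReal.toReal_mono ENNReal.one_ne_top (p.coe_le_one a)
  simpa using this

theorem eventually_exists_gapBound (hP : P.IsPRC ρ δ ε μ) (hQ : ∀ κ, 1 ≤ Q κ)
    (hPQ : P.QueriesAtMost Q) (hδ : ∀ κ, 0 ≤ δ κ) (hμ : ∀ κ, 0 ≤ μ κ) (k : ℕ) :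
    ∀ᶠ κ in atTop, ∃ e, k * (1 - (ρ κ : ℝ)) ≤ e ∧
      GapBound κ (Q κ) (P.blockLen κ) (ε κ) (δ κ + μ κ) e := by
  obtain ⟨p, hp⟩ := hP.polyKey
  let m : ℕ → ℕ := fun κ => κ ^ (2 * (k + 1)) * (p.eval κ + κ * (κ ^ k + κ ^ (17 * k)) + 2)
  have hm : PolyBounded m := by
    refine ⟨Polynomial.X ^ (2 * (k + 1)) * (p + Polynomial.X * (Polynomial.X ^ k +
      Polynomial.X ^ (17 * k)) + 2), fun κ => le_of_eq ?_⟩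
    simp [m]
  -- Pseudorandomness needs an adversary for every `κ`, so a constant one is used where `κ = 0` or
  -- `Q κ` exceeds `κ ^ k`.
  have hA : ∀ κ, ∃ A : (Fin (m κ) → BitString (P.blockLen κ)) → PMF Bool,
      1 ≤ κ → Q κ ≤ κ ^ k → ∀ δ ε μ : ℝ,
      |(P.realExp κ (m κ) A true).toReal - (P.idealExp κ (m κ) A true).toReal| ≤ ε →
      1 - δ ≤ (P.completenessExp κ (ρ κ) true).toReal →
      (∀ x, 1 - μ ≤ (P.soundnessExp κ x false).toReal) →
      ∃ T : ℝ, 0 ≤ T ∧ T ≤ 2 * ε + 2 * ((κ : ℝ) ^ (k + 1))⁻¹ ∧ (P.blockLen κ = 0 → T = 0) ∧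
        1 - δ - μ ≤ 2 * T + Q κ * (Q κ / (κ ^ (17 * k) : ℕ) : ℝ) ^ ((1 - (ρ κ : ℝ)) / 4) ∧
        1 - δ ≤ 2 ^ Q κ * (μ + T) := by
    intro κ
    by_cases h : 1 ≤ κ ∧ Q κ ≤ κ ^ k
    · have h1 : (1 : ℝ) ≤ κ := by exact_mod_cast h.1
      have hpos : 0 < κ := h.1
      obtain ⟨A, hA⟩ := exists_adversary_bound (P := P) (κ := κ) (ρ := ρ κ) (hPQ κ).1
        (fun sk => ((hPQ κ).2 sk).1) (fun sk => ((hPQ κ).2 sk).2)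
        (D := κ ^ (17 * k)) (by positivity) (s := ((κ : ℝ) ^ (k + 1))⁻¹) (by positivity)
        (inv_le_one_of_one_le₀ (one_le_pow₀ h1)) (m := m κ) (by positivity)
        (card_bound h.1 (hp κ) h.2)
      exact ⟨A, fun _ _ => hA⟩
    · exact ⟨fun _ => PMF.pure true, fun h1 h2 => absurd ⟨h1, h2⟩ h⟩
  choose A hA using hA
  filter_upwards [hP.pseudorandom m hm A, eventually_ge_atTop 16] with κ hε hκ
  have hκ' : (16 : ℝ) ≤ κ := by exact_mod_cast hκ
  have hκ0 : (0 : ℝ) < κ := by linarith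
  have hθ0 : 0 ≤ 1 - (ρ κ : ℝ) := by linarith [(ρ κ).2.2]
  have hθ1 : 1 - (ρ κ : ℝ) ≤ 1 := by linarith [(ρ κ).2.1]
  -- If `Q² κ^(-kθ) ≥ 1`, with `θ = 1 - ρ`, the bound is trivial. Otherwise `Q ≤ κ ^ k`, so no
  -- separate growth assumption on `Q` is needed.
  rcases le_or_gt 1 ((Q κ : ℝ) ^ 2 * (κ : ℝ) ^ (-(k * (1 - (ρ κ : ℝ))))) with hy | hy
  · exact ⟨_, le_rfl, gapBound_of_one_le (add_nonneg (hδ κ) (hμ κ)) hy⟩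
  · have hQ' : (1 : ℝ) ≤ Q κ := by exact_mod_cast hQ κ
    have hQk : (Q κ : ℝ) ≤ (κ : ℝ) ^ k := by
      rw [Real.rpow_neg hκ0.le, ← div_eq_mul_inv, div_lt_one (Real.rpow_pos_of_pos hκ0 _)] at hy
      calc (Q κ : ℝ) ≤ (Q κ : ℝ) ^ 2 := by nlinarith
        _ ≤ (κ : ℝ) ^ (k * (1 - (ρ κ : ℝ))) := hy.le
        _ ≤ (κ : ℝ) ^ (k : ℝ) := Real.rpow_le_rpow_of_exponent_le (by linarith)
            (mul_le_of_le_one_right (Nat.cast_nonneg k) hθ1)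
        _ = _ := Real.rpow_natCast _ _
    obtain ⟨T, -, hT, hn, h1, h2⟩ := hA κ (by omega) (by exact_mod_cast hQk) (δ κ) (ε κ) (μ κ) hε
      (hP.complete κ) (hP.sound κ)
    exact exists_gapBound hκ (hQ κ) hθ0 hθ1 ((abs_nonneg _).trans hε) (hδ κ) hy hQk hT hn h1 h2
      (hμ κ)

end ZeroBitCode

/-! ### Negligible functions and the consequence for constant noise rate. -/

theorem PolyBounded.exists_real {f : ℕ → ℕ} (hf : PolyBounded f) :
    ∃ p : Polynomial ℝ, ∀ κ : ℕ, (f κ : ℝ) ≤ p.eval (κ : ℝ) := by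
  obtain ⟨p, hp⟩ := hf
  refine ⟨p.map (Nat.castRingHom ℝ), fun κ => ?_⟩
  rw [Polynomial.eval_natCast_map]
  exact Nat.cast_le.2 (hp κ)

theorem Negligible.polyBounded_mul {f : ℕ → ℕ} {g : ℕ → ℝ} (hf : PolyBounded f)
    (hg : Negligible g) : Negligible fun κ => (f κ : ℝ) * g κ := by
  obtain ⟨p, hp⟩ := hf.exists_real
  refine (SuperpolynomialDecay.polynomial_mul hg p).trans_abs_le fun κ => ?_
  rw [abs_mul, abs_mul]
  refine mul_le_mul_of_nonneg_right ?_ (abs_nonneg _)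
  rw [abs_of_nonneg (Nat.cast_nonneg _)]
  exact (hp κ).trans (le_abs_self _)

theorem Negligible.sqrt {g : ℕ → ℝ} (hg : Negligible g) : Negligible fun κ => √(g κ) := by
  intro N
  have h := (Real.continuous_sqrt.tendsto _).comp (hg (2 * N))
  rw [Real.sqrt_zero] at h
  refine h.congr fun κ => ?_
  rw [Function.comp_apply, pow_mul', Real.sqrt_mul (sq_nonneg _), Real.sqrt_sq (by positivity)]

theorem negligible_rpow_neg {η : ℕ → ℝ} (h : Tendsto η atTop atTop) :
    Negligible fun κ => (κ : ℝ) ^ (-η κ) := by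
  intro N
  have h0 : Tendsto (fun κ : ℕ => ((κ : ℝ))⁻¹) atTop (nhds 0) := tendsto_inv_atTop_nhds_zero_nat
  refine squeeze_zero' (Eventually.of_forall fun κ => by positivity) ?_ h0
  filter_upwards [h.eventually_ge_atTop (N + 1), eventually_ge_atTop 1] with κ hη hκ
  have hκ1 : (1 : ℝ) ≤ κ := by exact_mod_cast hκ
  have hκ0 : (0 : ℝ) < κ := by linarith
  rw [← Real.rpow_natCast, ← Real.rpow_add hκ0, ← Real.rpow_neg_one]
  exact Real.rpow_le_rpow_of_exponent_le hκ1 (by linarith)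

theorem tendsto_atTop_of_isLittleO {θ η : ℕ → ℝ} (hη : ∀ κ, 0 ≤ η κ) (h : θ =o[atTop] η) {c : ℝ}
    (hc : 0 < c) (hθ : ∀ᶠ κ in atTop, c ≤ θ κ) : Tendsto η atTop atTop := by
  rw [tendsto_atTop]
  intro b
  have hb : 0 < c / (|b| + 1) := by positivity
  filter_upwards [isLittleO_iff.1 h hb, hθ] with κ h1 h2
  rw [Real.norm_of_nonneg (hη κ), Real.norm_of_nonneg (hc.le.trans h2)] at h1
  have h3 := h2.trans h1
  rw [div_mul_eq_mul_div, le_div_iff₀ (by positivity)] at h3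
  have := le_of_mul_le_mul_left h3 hc
  linarith [le_abs_self b]

end

theorem mainTheorem1 :
    ∃ C : ℝ, 0 < C ∧
      ∀ (P : ZeroBitCode) (ρ : ℕ → unitInterval) (δ ε μ : ℕ → ℝ) (Q : ℕ → ℕ),
        P.IsPRC ρ δ ε μ → (∀ κ, 1 ≤ Q κ) → P.QueriesAtMost Q →
        (∃ η : ℕ → ℝ, (∀ κ, 0 ≤ η κ) ∧
          (fun κ => 1 - (ρ κ : ℝ)) =o[atTop] η ∧
          ∀ κ : ℕ, δ κ + μ κ ≥
            1 - (Q κ : ℝ) ^ 2 * (κ : ℝ) ^ (-η κ)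
              - C * ((Q κ : ℝ) ^ 2 * Real.sqrt (ε κ * (P.blockLen κ : ℝ)))) ∧
        (PolyBounded P.blockLen → PolyBounded Q → Negligible ε →
          (∃ r : ℝ, r < 1 ∧ ∀ᶠ κ in atTop, (ρ κ : ℝ) ≤ r) →
          ∃ ν : ℕ → ℝ, Negligible ν ∧ ∀ κ, δ κ + μ κ ≥ 1 - ν κ) := by
  refine ⟨4, by norm_num, fun P ρ δ ε μ Q hP hQ hPQ => ?_⟩
  have hδ : ∀ κ, 0 ≤ δ κ := fun κ => by
    linarith [hP.complete κ,
      ZeroBitCode.toReal_apply_le_one (P.completenessExp κ (ρ κ)) true]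
  have hμ : ∀ κ, 0 ≤ μ κ := fun κ => by
    linarith [hP.sound κ fun _ => false,
      ZeroBitCode.toReal_apply_le_one (P.soundnessExp κ fun _ => false) false]
  obtain ⟨η, hη0, hηo, hη⟩ := exists_exponent_of_forall
    (θ := fun κ => 1 - (ρ κ : ℝ)) (fun κ => sub_nonneg.2 (ρ κ).2.2)
    (B := fun κ => GapBound κ (Q κ) (P.blockLen κ) (ε κ) (δ κ + μ κ))
    -- The exponent `0` is valid for every `κ`, including `κ = 0` by `0 ^ 0 = 1`, since `Q ≥ 1`
    -- makes the right side at most `0`. It covers the finitely many small `κ`.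
    (fun κ => gapBound_of_one_le (add_nonneg (hδ κ) (hμ κ)) (by
      rw [neg_zero, Real.rpow_zero, mul_one]
      exact one_le_pow₀ (by exact_mod_cast hQ κ)))
    (ZeroBitCode.eventually_exists_gapBound hP hQ hPQ hδ hμ)
  refine ⟨⟨η, hη0, hηo, hη⟩, fun hn hQp hε ⟨r, hr, hρ⟩ => ?_⟩
  have hηt : Tendsto η atTop atTop := tendsto_atTop_of_isLittleO hη0 hηo (sub_pos.2 hr)
    (hρ.mono fun κ h => by linarith)
  have hsq : ∀ g : ℕ → ℝ, Negligible g → Negligible fun κ => (Q κ : ℝ) ^ 2 * g κ := fun g hg => by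
    simpa only [sq, mul_assoc] using (hg.polyBounded_mul hQp).polyBounded_mul hQp
  refine ⟨_, (hsq _ (negligible_rpow_neg hηt)).add
    ((hsq _ (hε.polyBounded_mul hn).sqrt).const_mul 4), fun κ => ?_⟩
  have := hη κ
  simp only [GapBound, mul_comm (ε κ)] at this
  simp only [Pi.add_apply]
  linarith
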